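/- Let $X$ be a real random variable with finite moments $m_k=\mathbf E[X^k]$ of all positive integer orders $k$ and with a density function $f$ on $\mathbb R$. Suppose that $f$ satisfies Condition L: $f$ is symmetric about zero, and for some $x_0\ge 0$, $f$ is strictly positive and differentiable on $(x_0,\infty)$, and $L_f(x)=-xf'(x)/f(x)$ is increasing (not necessarily strictly) on $(x_0,\infty)$ with $L_f(x)\to\infty$ as $x\to\infty$. For $c\ge 0$ let $$K_c[f]=\int_{|x|\ge c}\frac{-\log f(x)}{1+x^2}\,dx\in(-\infty,\infty]\qquad(-\log 0=\infty).$$ A distribution on $\mathbb R$ with finite moments of all orders is called M-det if no other probability distribution on $\mathbb R$ has the same moment sequence, and M-indet otherwise; a distribution on $[0,\infty)$ is called M-det on $[0,\infty)$ if no other probability distribution on $[0,\infty)$ has the same moment sequence. (i) If the Krein integral is infinite, i.e. $K_c[f]=\infty$ for every $c\ge 0$, then $X$ satisfies Carleman's condition $\sum_{k=1}^\infty m_{2k}^{-1/(2k)}=\infty$; moreover, $X$ is M-det, and $X^2$ is M-det both on $\mathbb R$ and on $[0,\infty)$. (ii) Consequently, Krein's condition characterizes indeterminacy: $X$ is M-indet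 if and only if $K_c[f]<\infty$ for some $c\ge 0$. -/

import Mathlib

open MeasureTheory Filter Set

open scoped ENNReal

noncomputable section

namespace MomentProblem

/-- The distribution `μ` has finite (absolute) moments of all orders. -/
def HasFiniteMoments (μ : Measure ℝ) : Prop :=
  ∀ k : ℕ, Integrable (fun x : ℝ => x ^ k) μ

/-- Two distributions have the same moment sequence. -/
def SameMoments (μ ν : Measure ℝ) : Prop :=
  ∀ k : ℕ, ∫ x, x ^ k ∂ν = ∫ x, x ^ k ∂μ

/-- `μ` is moment-determinate on `ℝ` (Hamburger sense): it has finite moments of all orders, and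
it is the only probability distribution on `ℝ` with its moment sequence. -/
def MDet (μ : Measure ℝ) : Prop :=
  HasFiniteMoments μ ∧
    ∀ ν : Measure ℝ, IsProbabilityMeasure ν → HasFiniteMoments ν → SameMoments μ ν → ν = μ

/-- `μ` is moment-determinate on `[0, ∞)` (Stieltjes sense): it is carried by `[0, ∞)`, has finite
moments of all orders, and is the only probability distribution carried by `[0, ∞)` with its
moment sequence. -/
def MDetStieltjes (μ : Measure ℝ) : Prop :=
  μ (Iio 0) = 0 ∧ HasFiniteMoments μ ∧
    ∀ ν : Measure ℝ, IsProbabilityMeasure ν → ν (Iio 0) = 0 → HasFiniteMoments ν →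
      SameMoments μ ν → ν = μ

/-- `μ` is moment-indeterminate on `ℝ`: it has finite moments of all orders, and some other
probability distribution on `ℝ` has the same moment sequence. -/
def MIndet (μ : Measure ℝ) : Prop :=
  HasFiniteMoments μ ∧
    ∃ ν : Measure ℝ, IsProbabilityMeasure ν ∧ HasFiniteMoments ν ∧ SameMoments μ ν ∧ ν ≠ μ

/-- The Carleman quantity `∑_{k ≥ 1} m_{2k} ^ (-1 / (2k))` (Hamburger case), in `[0, ∞]`; the
summation index is shifted by one. -/
def carlemanQuantity (μ : Measure ℝ) : ℝ≥0∞ :=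
  ∑' k : ℕ, ENNReal.ofReal (∫ x, x ^ (2 * (k + 1)) ∂μ) ^ (-(1 / (2 * ((k : ℝ) + 1))))

/-- Carleman's condition (Hamburger case). -/
def CarlemanCondition (μ : Measure ℝ) : Prop :=
  carlemanQuantity μ = ⊤

/-- `f` is a density function of the distribution `μ` with respect to Lebesgue measure. -/
structure IsDensity (f : ℝ → ℝ) (μ : Measure ℝ) : Prop where
  measurable : Measurable f
  nonneg : ∀ x, 0 ≤ f x
  eq_withDensity : μ = volume.withDensity (fun x => ENNReal.ofReal (f x))

/-- The Krein integral `∫_{|x| ≥ c} (-log f(x)) / (1 + x²) dx`, with `-log 0 = ∞`, as the extended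
real number `∫ (positive part) - ∫ (negative part)`. The second integral is finite for every
density `f`, because `log⁺ y ≤ y` for `y ≥ 0`. -/
def kreinIntegral (f : ℝ → ℝ) (c : ℝ) : EReal :=
  ((∫⁻ x in {x : ℝ | c ≤ |x|},
      (-ENNReal.log (ENNReal.ofReal (f x))).toENNReal / ENNReal.ofReal (1 + x ^ 2) : ℝ≥0∞) : EReal)
  - ((∫⁻ x in {x : ℝ | c ≤ |x|},
      (ENNReal.log (ENNReal.ofReal (f x))).toENNReal / ENNReal.ofReal (1 + x ^ 2) : ℝ≥0∞) : EReal)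

/-- Krein's condition: for some `c ≥ 0`, the Krein integral over `|x| ≥ c` is less than `∞`. -/
def KreinCondition (f : ℝ → ℝ) : Prop :=
  ∃ c : ℝ, 0 ≤ c ∧ kreinIntegral f c < ⊤

/-- Condition L (Hamburger case): `f` is symmetric about zero and, for some `x₀ ≥ 0`, strictly
positive and differentiable on `(x₀, ∞)`, where `L_f(x) = -x f'(x) / f(x)` is increasing (in the
weak sense) and tends to `∞` as `x → ∞`. -/
def ConditionL (f : ℝ → ℝ) : Prop :=
  (∀ x, f (-x) = f x) ∧
    ∃ x₀ : ℝ, 0 ≤ x₀ ∧ (∀ x ∈ Ioi x₀, 0 < f x) ∧ DifferentiableOn ℝ f (Ioi x₀) ∧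
      MonotoneOn (fun x => -(x * deriv f x) / f x) (Ioi x₀) ∧
      Tendsto (fun x => -(x * deriv f x) / f x) atTop atTop

end MomentProblem

end

open scoped Topology NNReal

/-! Divergence of the Krein integral implies Carleman's condition by reading Condition L
quantitatively. If `L_f ≥ 2n + 2` beyond `y`, then `f(x) x^(2n+2)` decreases there, so `m_{2n}` is
at most a fixed constant times `y^(2n)` (`ofReal_even_moment_le`). With `s_k` the threshold at which
`L_f` reaches `2k + 4`, Carleman's series therefore dominates a multiple of `∑ 1/s_k`. If that sum
were finite, so would be `∫ L_f / x²`, and by parts `∫ -log f / x²`, hence a Krein integral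
(`ConditionL.carlemanCondition`).

Carleman's condition gives determinacy through quasi-analyticity. If `q h` is orthogonal to all
monomials, its Fourier transform is flat at `0`, with derivatives bounded by square roots of even
moments; Bang's theorem makes it vanish. So the polynomial multiples of `q = (x - a)² + b²` are
dense in `L²(μ)`, and `1/q` is approximated by polynomials with an error that only the moments
control. A solution of the same moment problem thus has the same Poisson integrals, and these
determine it (`mdet_of_orthogonal`). For `X²` the orthogonality is pulled back along `x ↦ x²`, the
odd moments vanishing by symmetry.

Conversely, let a Krein integral be finite. Subharmonicity of `log |p|` off the half-lines `|x| ≥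
c`, with Jensen's inequality for `exp`, bounds `|p(0)|` by a multiple of `∫_{|x| ≥ c} |p| x⁻² dμ`
(`RegularTail.abs_eval_zero_le`). By Hahn–Banach `p ↦ p(0)` is integration against some `v` with
`|v|` below that weight; then `x² v` is bounded, nonzero and orthogonal to all monomials, and
perturbs `μ` to another solution. The equivalence follows, because failure of Krein's condition is
exactly the hypothesis of the first part. -/

namespace MomentProblem

/-! ### Quasi-analyticity: Bang's theorem and Carleman's inequality -/

/-- One step of Bang's argument. -/
theorem bang_step {F : ℕ → ℝ → ℂ} {M : ℕ → ℝ} (hM : ∀ n, 0 < M n)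
    (hlc : Monotone fun n => M (n + 1) / M n)
    (hF : ∀ n t, HasDerivAt (F n) (F (n + 1) t) t) (hb : ∀ n t, ‖F n t‖ ≤ M n)
    {N : ℕ} {t s : ℝ} (ht : ∀ n, ‖F n t‖ ≤ Real.exp (n - (N + 1 : ℕ)) * M n)
    (hs : 0 ≤ s) (hs' : s ≤ Real.exp (-1) * (M N / M (N + 1))) (n : ℕ) :
    ‖F n (t + s)‖ ≤ Real.exp (n - N) * M n := by
  set ρ := M (N + 1) / M N with hρ
  have hρ0 : 0 < ρ := div_pos (hM _) (hM _)
  -- Descending induction on the order `n`, started at `N + 1` by the global bound. Passing from `n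
  -- + 1` to `n` costs a factor `e` from the weight and at most `ρ` from log-convexity, which is
  -- exactly the rate of the exponential majorant.
  have key : ∀ j n : ℕ, n + j = N + 1 → ∀ s, 0 ≤ s →
      ‖F n (t + s)‖ ≤ Real.exp (n - (N + 1 : ℕ)) * M n * Real.exp (Real.exp 1 * ρ * s) := by
    intro j
    induction j with
    | zero =>
      intro n hn s hs
      have : n = N + 1 := by omega
      subst this
      have h1 : (1 : ℝ) ≤ Real.exp (Real.exp 1 * ρ * s) := Real.one_le_exp (by positivity)
      calc _ ≤ M (N + 1) := hb _ _
        _ ≤ _ := by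
          rw [sub_self, Real.exp_zero, one_mul]
          exact le_mul_of_one_le_right (hM _).le h1
    | succ j ih =>
      intro n hn s hs
      have ih' := ih (n + 1) (by omega)
      have hB : ∀ x, HasDerivAt
          (fun s => Real.exp (n - (N + 1 : ℕ)) * M n * Real.exp (Real.exp 1 * ρ * s))
          (Real.exp (n - (N + 1 : ℕ)) * M n * (Real.exp (Real.exp 1 * ρ * x) *
            (Real.exp 1 * ρ))) x := by
        intro x
        have := ((hasDerivAt_id x).const_mul (Real.exp 1 * ρ)).exp.const_mul
          (Real.exp (n - (N + 1 : ℕ)) * M n)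
        simpa using this
      have hFs : ∀ x, HasDerivAt (fun s => F n (t + s)) (F (n + 1) (t + x)) x := by
        intro x
        exact (hF n (t + x)).comp_const_add t x
      refine image_norm_le_of_norm_deriv_right_le_deriv_boundary (a := 0) (b := s)
        (f := fun s => F n (t + s)) (f' := fun x => F (n + 1) (t + x))
        (fun x _ => (hFs x).continuousAt.continuousWithinAt)
        (fun x _ => (hFs x).hasDerivWithinAt) (by simpa using ht n) hB
        (fun x hx => (ih' x hx.1).trans ?_) ⟨hs, le_rfl⟩
      have h1 : M (n + 1) ≤ ρ * M n := by
        have := hlc (show n ≤ N by omega)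
        simp only at this
        rwa [div_le_iff₀ (hM n)] at this
      have h2 : Real.exp ((n + 1 : ℕ) - (N + 1 : ℕ)) = Real.exp (n - (N + 1 : ℕ)) * Real.exp 1 := by
        rw [← Real.exp_add]; congr 1; push_cast; ring
      rw [h2]
      calc _ ≤ Real.exp (n - (N + 1 : ℕ)) * Real.exp 1 * (ρ * M n) *
            Real.exp (Real.exp 1 * ρ * x) := by gcongr
        _ = _ := by ring
  rcases le_or_gt n (N + 1) with hn | hn
  · obtain ⟨j, hj⟩ := Nat.exists_eq_add_of_le hn
    refine (key j n hj.symm s hs).trans ?_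
    -- The step length is chosen so that the growth factor is at most `e`, the loss of one level.
    have h3 : Real.exp 1 * ρ * s ≤ 1 := by
      calc Real.exp 1 * ρ * s ≤ Real.exp 1 * ρ * (Real.exp (-1) * (M N / M (N + 1))) := by gcongr
        _ = (Real.exp 1 * Real.exp (-1)) * (ρ * (M N / M (N + 1))) := by ring
        _ = 1 := by
          rw [← Real.exp_add, hρ]
          have := (hM N).ne'
          have := (hM (N + 1)).ne'
          field_simp
          simp
    calc _ ≤ Real.exp (n - (N + 1 : ℕ)) * M n * Real.exp 1 := by
          have := hM n
          gcongr
      _ = Real.exp (n - (N + 1 : ℕ)) * Real.exp 1 * M n := by ring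
      _ = _ := by rw [← Real.exp_add]; congr 2; push_cast; ring
  · refine (hb _ _).trans (le_mul_of_one_le_left (hM n).le (Real.one_le_exp ?_))
    have : (N : ℝ) + 1 < n := by exact_mod_cast hn
    linarith

/-- **Bang's theorem** (one-sided form of the Denjoy–Carleman theorem). -/
theorem bang_nonneg {F : ℕ → ℝ → ℂ} {M : ℕ → ℝ} (hM : ∀ n, 0 < M n)
    (hlc : Monotone fun n => M (n + 1) / M n) (hdiv : ¬ Summable fun n => M n / M (n + 1))
    (hF : ∀ n t, HasDerivAt (F n) (F (n + 1) t) t) (hb : ∀ n t, ‖F n t‖ ≤ M n)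
    (h0 : ∀ n, F n 0 = 0) {t : ℝ} (ht : 0 ≤ t) : F 0 t = 0 := by
  have hr : ∀ n, 0 ≤ M n / M (n + 1) := fun n => (div_pos (hM _) (hM _)).le
  -- At `0` every level holds, since all derivatives vanish. Descending from level `k + d` to level
  -- `k` reaches as far as the sum of the `d` step lengths; `max 0 (t - a)` covers a `t` shorter
  -- than the last step.
  have key : ∀ d k : ℕ, ∀ t, 0 ≤ t →
      t ≤ ∑ j ∈ Finset.range d, Real.exp (-1) * (M (k + j) / M (k + j + 1)) →
      ∀ n, ‖F n t‖ ≤ Real.exp (n - k) * M n := by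
    intro d
    induction d with
    | zero =>
      intro k t ht ht' n
      have : t = 0 := le_antisymm (by simpa using ht') ht
      rw [this, h0, norm_zero]
      have := hM n
      positivity
    | succ d ih =>
      intro k t ht ht' n
      rw [Finset.sum_range_succ'] at ht'
      set a := Real.exp (-1) * (M k / M (k + 1)) with ha
      have ha0 : 0 ≤ a := mul_nonneg (Real.exp_pos _).le (hr _)
      have h1 := ih (k + 1) (max 0 (t - a)) (le_max_left _ _) (by
        refine max_le (Finset.sum_nonneg fun j _ => mul_nonneg (Real.exp_pos _).le (hr _)) ?_
        have : ∀ j, k + 1 + j = k + (j + 1) := fun j => by omega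
        simp only [this]
        simp only [add_zero] at ht'
        linarith)
      have h2 := bang_step hM hlc hF hb (s := t - max 0 (t - a)) h1
        (by rw [sub_nonneg]; exact max_le ht (by linarith))
        (by have := le_max_right 0 (t - a); linarith) n
      simpa using h2
  -- Divergence means that `t` is reached from any starting level, so the level `k` is arbitrary.
  have hP : ∀ k : ℕ, ‖F 0 t‖ ≤ Real.exp (-k) * M 0 := by
    intro k
    have h1 : ¬ Summable fun j => Real.exp (-1) * (M (k + j) / M (k + j + 1)) := by
      rw [summable_mul_left_iff (Real.exp_pos _).ne']
      intro h
      refine hdiv ((summable_nat_add_iff k).1 ?_)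
      simpa [add_comm, add_left_comm, add_assoc] using h
    rw [not_summable_iff_tendsto_nat_atTop_of_nonneg
      (fun j => mul_nonneg (Real.exp_pos _).le (hr _))] at h1
    obtain ⟨d, hd⟩ := (h1.eventually_ge_atTop t).exists
    simpa using key d k t ht hd 0
  have hlim : Tendsto (fun k : ℕ => Real.exp (-k) * M 0) atTop (𝓝 0) := by
    have : Tendsto (fun k : ℕ => Real.exp (-(k : ℝ))) atTop (𝓝 0) :=
      Real.tendsto_exp_neg_atTop_nhds_zero.comp tendsto_natCast_atTop_atTop
    simpa using this.mul_const (M 0)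
  exact norm_le_zero_iff.1 (ge_of_tendsto' hlim hP)

theorem bang {F : ℕ → ℝ → ℂ} {M : ℕ → ℝ} (hM : ∀ n, 0 < M n)
    (hlc : Monotone fun n => M (n + 1) / M n) (hdiv : ¬ Summable fun n => M n / M (n + 1))
    (hF : ∀ n t, HasDerivAt (F n) (F (n + 1) t) t) (hb : ∀ n t, ‖F n t‖ ≤ M n)
    (h0 : ∀ n, F n 0 = 0) (t : ℝ) : F 0 t = 0 := by
  rcases le_total 0 t with ht | ht
  · exact bang_nonneg hM hlc hdiv hF hb h0 ht
  · have := bang_nonneg (F := fun n t => (-1) ^ n * F n (-t)) hM hlc hdiv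
      (fun n t => by
        have h := ((hF n (-t)).scomp t (hasDerivAt_neg t)).const_mul ((-1 : ℂ) ^ n)
        refine h.congr_deriv ?_
        simp [pow_succ])
      (fun n t => by simpa using hb n (-t)) (by simp [h0]) (neg_nonneg.2 ht)
    simpa using this

/-- **Carleman's inequality**, in qualitative form. -/
theorem summable_geom_mean {a : ℕ → ℝ} (ha : ∀ n, 0 < a n) (hs : Summable a) :
    Summable fun n : ℕ => (∏ i ∈ Finset.range (n + 1), a i) ^ (1 / ((n : ℝ) + 1)) := by
  have hfac : ∀ n : ℕ, ((n : ℝ) + 2) ^ (n + 1) ≤ Real.exp 1 ^ (n + 1) * (n + 1).factorial := by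
    intro n
    induction n with
    | zero =>
      have := Real.add_one_le_exp (1 : ℝ)
      norm_num
      linarith
    | succ n ih =>
      have h1 : ((n : ℝ) + 3) ^ (n + 2) ≤ ((n : ℝ) + 2) ^ (n + 2) * Real.exp 1 := by
        have h2 : ((n : ℝ) + 3) = (n + 2) * (1 + 1 / (n + 2)) := by field_simp; ring
        have h3 : (1 + 1 / ((n : ℝ) + 2)) ^ (n + 2) ≤ Real.exp 1 := by
          have h4 : 1 + 1 / ((n : ℝ) + 2) ≤ Real.exp (1 / (n + 2)) := by
            have := Real.add_one_le_exp (1 / ((n : ℝ) + 2)); linarith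
          calc _ ≤ Real.exp (1 / ((n : ℝ) + 2)) ^ (n + 2) := by gcongr
            _ = Real.exp 1 := by
              rw [← Real.exp_nat_mul]; congr 1; push_cast; field_simp
        rw [h2, mul_pow]; gcongr
      push_cast [Nat.factorial_succ] at ih ⊢
      calc ((n : ℝ) + 1 + 2) ^ (n + 1 + 1) = ((n : ℝ) + 3) ^ (n + 2) := by ring
        _ ≤ ((n : ℝ) + 2) ^ (n + 2) * Real.exp 1 := h1
        _ = ((n : ℝ) + 2) ^ (n + 1) * ((n + 2) * Real.exp 1) := by ring
        _ ≤ _ := by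
          refine (mul_le_mul_of_nonneg_right ih (by positivity)).trans (le_of_eq ?_)
          ring
  -- Pólya's device: AM–GM is applied to `(i + 1) * a i`. The geometric mean of the weights is at
  -- least `(n + 2) / e` by `hfac`, and the resulting coefficients telescope once the sums are
  -- swapped.
  have hbound : ∀ n : ℕ, (∏ i ∈ Finset.range (n + 1), a i) ^ (1 / ((n : ℝ) + 1)) ≤
      Real.exp 1 * (∑ i ∈ Finset.range (n + 1), (1 / (((n : ℝ) + 1) * (n + 2))) * ((i + 1) * a i)) := by
    intro n
    have hn1 : (0 : ℝ) < n + 1 := by positivity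
    have hp : 0 < ∏ i ∈ Finset.range (n + 1), a i := Finset.prod_pos fun i _ => ha i
    have hg := Real.geom_mean_le_arith_mean (Finset.range (n + 1)) (fun _ => 1)
      (fun i => ((i : ℝ) + 1) * a i) (fun _ _ => zero_le_one) (by simp; positivity)
      (fun i _ => mul_nonneg (by positivity) (ha i).le)
    simp only [Real.rpow_one, Finset.prod_mul_distrib, Finset.sum_const, Finset.card_range,
      nsmul_eq_mul, mul_one, one_mul] at hg
    have hfp : ∏ i ∈ Finset.range (n + 1), ((i : ℝ) + 1) = (n + 1).factorial := by
      rw [← Finset.prod_range_add_one_eq_factorial]; push_cast; rfl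
    rw [hfp] at hg
    push_cast at hg
    rw [Real.mul_rpow (by positivity) hp.le] at hg
    have h5 : ((n : ℝ) + 2) / Real.exp 1 ≤ ((n + 1).factorial : ℝ) ^ ((n : ℝ) + 1)⁻¹ := by
      rw [Real.le_rpow_inv_iff_of_pos (by positivity) (by positivity) hn1]
      have : ((n : ℝ) + 1) = ((n + 1 : ℕ) : ℝ) := by push_cast; rfl
      rw [this, Real.rpow_natCast, div_pow, div_le_iff₀ (by positivity)]
      have := hfac n
      linarith
    rw [← Finset.mul_sum]
    rw [one_div]
    have h6 := (mul_le_mul_of_nonneg_right h5 (Real.rpow_nonneg hp.le ((n : ℝ) + 1)⁻¹)).trans hg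
    have h7 : (∏ i ∈ Finset.range (n + 1), a i) ^ ((n : ℝ) + 1)⁻¹ =
      (Real.exp 1 / (n + 2)) * ((n + 2) / Real.exp 1 *
        (∏ i ∈ Finset.range (n + 1), a i) ^ ((n : ℝ) + 1)⁻¹) := by
      field_simp
    rw [h7]
    refine (mul_le_mul_of_nonneg_left h6 (by positivity)).trans (le_of_eq ?_)
    field_simp
  refine summable_of_sum_range_le (c := Real.exp 1 * ∑' i, a i)
    (fun n => Real.rpow_nonneg (Finset.prod_nonneg fun i _ => (ha i).le) _) fun N => ?_
  refine (Finset.sum_le_sum fun n _ => hbound n).trans ?_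
  rw [← Finset.mul_sum]
  refine mul_le_mul_of_nonneg_left ?_ (Real.exp_pos _).le
  have hswap : ∑ n ∈ Finset.range N, ∑ i ∈ Finset.range (n + 1),
      (1 / (((n : ℝ) + 1) * (n + 2))) * ((i + 1) * a i) =
      ∑ i ∈ Finset.range N, ∑ n ∈ Finset.Ico i N,
      (1 / (((n : ℝ) + 1) * (n + 2))) * ((i + 1) * a i) := by
    refine Finset.sum_comm' fun x y => ?_
    simp only [Finset.mem_range, Finset.mem_Ico]
    omega
  rw [hswap]
  refine (Finset.sum_le_sum (g := a) fun i hi => ?_).trans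
    (hs.sum_le_tsum _ fun i _ => (ha i).le)
  rw [← Finset.sum_mul]
  have htel : ∀ N, i ≤ N → ∑ n ∈ Finset.Ico i N, (1 / (((n : ℝ) + 1) * (n + 2))) =
      1 / ((i : ℝ) + 1) - 1 / ((N : ℝ) + 1) := by
    intro N hN
    induction N, hN using Nat.le_induction with
    | base => simp
    | succ N hN ih =>
      rw [Finset.sum_Ico_succ_top hN, ih]
      push_cast
      field_simp
      ring
  rw [htel N (Finset.mem_range.1 hi).le]
  have : (1 / ((i : ℝ) + 1) - 1 / ((N : ℝ) + 1)) ≤ 1 / ((i : ℝ) + 1) := by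
    have : 0 ≤ 1 / ((N : ℝ) + 1) := by positivity
    linarith
  calc _ ≤ 1 / ((i : ℝ) + 1) * ((i + 1) * a i) :=
        mul_le_mul_of_nonneg_right this (mul_nonneg (by positivity) (ha i).le)
    _ = a i := by field_simp

end MomentProblem

/-! ### Carleman's condition and orthogonality to all monomials -/

namespace MomentProblem

theorem integral_abs_mul_le_sqrt_mul_sqrt {α : Type*} [MeasurableSpace α] {μ : Measure α}
    {u v : α → ℝ} (hu : MemLp u 2 μ) (hv : MemLp v 2 μ) :
    ∫ x, |u x * v x| ∂μ ≤ √(∫ x, u x ^ 2 ∂μ) * √(∫ x, v x ^ 2 ∂μ) := by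
  have h := integral_mul_norm_le_Lp_mul_Lq (μ := μ) (f := u) (g := v) (p := 2) (q := 2)
    Real.HolderConjugate.two_two (by simpa using hu) (by simpa using hv)
  simp only [Real.norm_eq_abs, Real.rpow_two, sq_abs, ← Real.sqrt_eq_rpow] at h
  simpa only [abs_mul] using h

/-- An integrable function whose Fourier transform vanishes is zero almost everywhere. -/
theorem ae_eq_zero_of_integral_exp_eq_zero {μ : Measure ℝ} {g : ℝ → ℝ} (hg : Integrable g μ)
    (h : ∀ t : ℝ, ∫ x, Complex.exp (t * x * Complex.I) * g x ∂μ = 0) : g =ᵐ[μ] 0 := by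
  have hgn : Integrable (fun x => -g x) μ := hg.neg
  have := isFiniteMeasure_withDensity_ofReal hg.2
  have := isFiniteMeasure_withDensity_ofReal hgn.2
  have hint : ∀ (t : ℝ) (u : ℝ → ℝ), Integrable u μ →
      Integrable (fun x => ((max (u x) 0 : ℝ) : ℂ) * Complex.exp (t * x * Complex.I)) μ := by
    intro t u hu
    refine (hu.pos_part.ofReal (𝕜 := ℂ)).mul_bdd (c := 1)
      (by fun_prop) (Eventually.of_forall fun x => ?_)
    rw [← Complex.ofReal_mul, Complex.norm_exp_ofReal_mul_I]
  -- The positive and negative parts of `g` define finite measures with equal characteristic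
  -- functions.
  have heq : μ.withDensity (fun x => ENNReal.ofReal (g x)) =
      μ.withDensity (fun x => ENNReal.ofReal (-g x)) := by
    apply Measure.ext_of_charFun
    funext t
    rw [charFun_apply_real, charFun_apply_real,
      integral_withDensity_eq_integral_toReal_smul₀ hg.1.aemeasurable.ennreal_ofReal
        (Eventually.of_forall fun _ => ENNReal.ofReal_lt_top),
      integral_withDensity_eq_integral_toReal_smul₀ hgn.1.aemeasurable.ennreal_ofReal
        (Eventually.of_forall fun _ => ENNReal.ofReal_lt_top), ← sub_eq_zero]
    simp only [ENNReal.toReal_ofReal', Complex.real_smul]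
    rw [← integral_sub (hint t g hg) (hint t _ hgn), ← h t]
    congr 1
    funext x
    have : (g x : ℂ) = ((max (g x) 0 : ℝ) : ℂ) - ((max (-g x) 0 : ℝ) : ℂ) := by
      rw [← Complex.ofReal_sub]
      congr 1
      rcases le_total 0 (g x) with h | h
      · rw [max_eq_left h, max_eq_right (by linarith)]; ring
      · rw [max_eq_right h, max_eq_left (by linarith)]; ring
    rw [this]
    ring
  rw [withDensity_eq_iff hg.1.aemeasurable.ennreal_ofReal hgn.1.aemeasurable.ennreal_ofReal
    hg.lintegral_lt_top.ne] at heq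
  filter_upwards [heq] with x hx
  rcases lt_trichotomy (g x) 0 with h | h | h
  · rw [ENNReal.ofReal_of_nonpos h.le, eq_comm, ENNReal.ofReal_eq_zero] at hx
    simp only [Pi.zero_apply]; linarith
  · exact h
  · rw [eq_comm, ENNReal.ofReal_of_nonpos (by linarith), eq_comm, ENNReal.ofReal_eq_zero] at hx
    simp only [Pi.zero_apply]; linarith

section Moments

variable {μ : Measure ℝ}

theorem even_moment_pos (hm : HasFiniteMoments μ) (h0 : μ {0}ᶜ ≠ 0) (n : ℕ) :
    0 < ∫ x, x ^ (2 * n) ∂μ := by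
  have hnn : (0 : ℝ → ℝ) ≤ fun x => x ^ (2 * n) := fun x => by
    simpa [pow_mul] using pow_nonneg (sq_nonneg x) n
  rw [integral_pos_iff_support_of_nonneg hnn (hm _)]
  refine (pos_iff_ne_zero.2 h0).trans_le (measure_mono fun x hx => ?_)
  exact pow_ne_zero (2 * n) hx

/-- Nonpositive discriminant of `t ↦ ∫ x^(2n) (x² - t)²`. This is the log-convexity that `bang` asks
of its majorants. -/
theorem even_moment_sq_le (hm : HasFiniteMoments μ) (n : ℕ) :
    (∫ x, x ^ (2 * (n + 1)) ∂μ) ^ 2 ≤ (∫ x, x ^ (2 * n) ∂μ) * ∫ x, x ^ (2 * (n + 2)) ∂μ := by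
  have := discrim_le_zero (a := ∫ x, x ^ (2 * n) ∂μ) (b := -2 * ∫ x, x ^ (2 * (n + 1)) ∂μ)
    (c := ∫ x, x ^ (2 * (n + 2)) ∂μ) (fun t => by
      have h : 0 ≤ ∫ x, x ^ (2 * n) * (x ^ 2 - t) ^ 2 ∂μ :=
        integral_nonneg fun x => mul_nonneg (by rw [pow_mul]; positivity) (sq_nonneg _)
      have h2 : ∀ x : ℝ, x ^ (2 * n) * (x ^ 2 - t) ^ 2 =
          (t * t) * x ^ (2 * n) + (-2 * t) * x ^ (2 * (n + 1)) + x ^ (2 * (n + 2)) :=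
        fun x => by ring
      simp only [h2] at h
      have h3 : Integrable (fun x => t * t * x ^ (2 * n) + -2 * t * x ^ (2 * (n + 1))) μ :=
        ((hm _).const_mul _).add ((hm _).const_mul _)
      rw [integral_add h3 (hm _), integral_add ((hm _).const_mul _) ((hm _).const_mul _),
        integral_const_mul, integral_const_mul] at h
      linarith)
  rw [discrim] at this
  linarith

/-- Square roots of the even moments. -/
noncomputable def rootMoment (μ : Measure ℝ) (n : ℕ) : ℝ := √(∫ x, x ^ (2 * n) ∂μ)

theorem rootMoment_pos (hm : HasFiniteMoments μ) (h0 : μ {0}ᶜ ≠ 0) (n : ℕ) :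
    0 < rootMoment μ n := Real.sqrt_pos.2 (even_moment_pos hm h0 n)

theorem rootMoment_ratio_monotone (hm : HasFiniteMoments μ) (h0 : μ {0}ᶜ ≠ 0) :
    Monotone fun n => rootMoment μ (n + 1) / rootMoment μ n := by
  refine monotone_nat_of_le_succ fun n => ?_
  rw [div_le_div_iff₀ (rootMoment_pos hm h0 _) (rootMoment_pos hm h0 _), rootMoment, rootMoment,
    rootMoment, ← sq, ← Real.sqrt_mul (even_moment_pos hm h0 _).le,
    Real.sq_sqrt (even_moment_pos hm h0 _).le]
  refine Real.le_sqrt_of_sq_le ?_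
  have := even_moment_sq_le hm n
  linarith

/-- The product of the ratios telescopes, with `m_0 = 1`, so their geometric means are the terms of
Carleman's series; Carleman's inequality would make that series converge. -/
theorem not_summable_rootMoment_ratio [IsProbabilityMeasure μ] (hm : HasFiniteMoments μ)
    (h0 : μ {0}ᶜ ≠ 0) (hC : CarlemanCondition μ) :
    ¬ Summable fun n => rootMoment μ n / rootMoment μ (n + 1) := by
  intro hs
  have hp := rootMoment_pos hm h0
  have hprod : ∀ n, ∏ i ∈ Finset.range (n + 1), rootMoment μ i / rootMoment μ (i + 1) =
      (rootMoment μ (n + 1))⁻¹ := by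
    intro n
    induction n with
    | zero => simp [rootMoment]
    | succ n ih =>
      rw [Finset.prod_range_succ, ih]
      have := (hp (n + 1)).ne'
      field_simp
  have h1 := summable_geom_mean (fun n => div_pos (hp n) (hp (n + 1))) hs
  simp only [hprod] at h1
  have h2 : ∀ n : ℕ, ENNReal.ofReal (∫ x, x ^ (2 * (n + 1)) ∂μ) ^ (-(1 / (2 * ((n : ℝ) + 1)))) =
      ENNReal.ofReal ((rootMoment μ (n + 1))⁻¹ ^ (1 / ((n : ℝ) + 1))) := by
    intro n
    have hpos := even_moment_pos hm h0 (n + 1)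
    rw [ENNReal.ofReal_rpow_of_pos hpos, rootMoment, Real.sqrt_eq_rpow, ← Real.rpow_neg hpos.le,
      ← Real.rpow_mul hpos.le]
    congr 2
    field_simp
  rw [CarlemanCondition, carlemanQuantity] at hC
  simp only [h2] at hC
  exact h1.tsum_ofReal_ne_top hC

/-- By log-convexity `m_{2(n+d)} / m_{2n}` increases with `n`, hence is at least its value at `n =
0`. The multiplier `q` thus only shifts the index of the majorant. -/
theorem even_moment_le_mul_shift (hm : HasFiniteMoments μ) (h0 : μ {0}ᶜ ≠ 0) (d n : ℕ) :
    ∫ x, x ^ (2 * n) ∂μ ≤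
      (∫ x, x ^ (2 * 0) ∂μ) / (∫ x, x ^ (2 * (0 + d)) ∂μ) * ∫ x, x ^ (2 * (n + d)) ∂μ := by
  have hp := even_moment_pos hm h0
  have hmono : Monotone fun n => (∫ x, x ^ (2 * (n + 1)) ∂μ) / ∫ x, x ^ (2 * n) ∂μ := by
    refine monotone_nat_of_le_succ fun n => ?_
    rw [div_le_div_iff₀ (hp _) (hp _)]
    have := even_moment_sq_le hm n
    linarith
  have key : Monotone fun n => (∫ x, x ^ (2 * (n + d)) ∂μ) / ∫ x, x ^ (2 * n) ∂μ := by
    refine monotone_nat_of_le_succ fun n => ?_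
    have := hmono (Nat.le_add_right n d)
    simp only at this
    rw [div_le_div_iff₀ (hp _) (hp _)] at this ⊢
    have e : n + 1 + d = n + d + 1 := by omega
    rw [e]
    linarith
  have := key (Nat.zero_le n)
  simp only at this
  rw [div_le_div_iff₀ (hp _) (hp _)] at this
  rw [div_mul_eq_mul_div, le_div_iff₀ (hp _)]
  linarith

/-- Under Carleman's condition, a function of at most polynomial size relative to `L²` that is
orthogonal to all monomials vanishes. -/
theorem CarlemanCondition.ae_eq_zero_of_orthogonal [IsProbabilityMeasure μ]
    (hC : CarlemanCondition μ) (hm : HasFiniteMoments μ) (h0 : μ {0}ᶜ ≠ 0) {h q : ℝ → ℝ}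
    (hh : MemLp h 2 μ) (hq : Measurable q) {K : ℝ} {d : ℕ}
    (hqb : ∀ x, q x ^ 2 ≤ K * (1 + x ^ (2 * d)))
    (horth : ∀ k : ℕ, ∫ x, x ^ k * (q x * h x) ∂μ = 0) :
    (fun x => q x * h x) =ᵐ[μ] 0 := by
  have hK : 0 ≤ K := by
    have h1 := (sq_nonneg (q 0)).trans (hqb 0)
    have h2 : (0 : ℝ) < 1 + 0 ^ (2 * d) := by positivity
    exact nonneg_of_mul_nonneg_left h1 h2
  have hxb : ∀ (n : ℕ) (x : ℝ), (x ^ n * q x) ^ 2 ≤ K * (x ^ (2 * n) + x ^ (2 * (n + d))) := by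
    intro n x
    calc (x ^ n * q x) ^ 2 = x ^ (2 * n) * q x ^ 2 := by ring
      _ ≤ x ^ (2 * n) * (K * (1 + x ^ (2 * d))) :=
        mul_le_mul_of_nonneg_left (hqb x) (by rw [pow_mul]; positivity)
      _ = _ := by ring
  have hbi : ∀ n : ℕ, Integrable (fun x : ℝ => K * (x ^ (2 * n) + x ^ (2 * (n + d)))) μ :=
    fun n => ((hm _).add (hm _)).const_mul K
  have hL2 : ∀ n : ℕ, MemLp (fun x => x ^ n * q x) 2 μ := by
    intro n
    have hmeas : AEStronglyMeasurable (fun x => x ^ n * q x) μ :=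
      ((measurable_id.pow_const n).mul hq).aestronglyMeasurable
    rw [memLp_two_iff_integrable_sq hmeas]
    refine (hbi n).mono' (hmeas.pow 2) (Eventually.of_forall fun x => ?_)
    rw [Real.norm_of_nonneg (sq_nonneg _)]
    exact hxb n x
  have hint : ∀ n : ℕ, Integrable (fun x => x ^ n * (q x * h x)) μ := by
    intro n
    refine ((hL2 n).integrable_mul hh).congr (Eventually.of_forall fun x => ?_)
    simp [mul_assoc]
  set c₀ : ℝ := (∫ x, x ^ (2 * 0) ∂μ) / (∫ x, x ^ (2 * (0 + d)) ∂μ) with hc₀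
  have hc₀' : 0 ≤ c₀ := (div_pos (even_moment_pos hm h0 _) (even_moment_pos hm h0 _)).le
  set c : ℝ := √(∫ x, h x ^ 2 ∂μ) * √(K * (c₀ + 1)) with hc
  -- `c + 1` rather than `c` keeps the majorant positive even when `c = 0`.
  have hbound : ∀ n : ℕ, ∫ x, |x ^ n * (q x * h x)| ∂μ ≤ (c + 1) * rootMoment μ (n + d) := by
    intro n
    have h1 := integral_abs_mul_le_sqrt_mul_sqrt (hL2 n) hh
    have h2 : ∫ x, (x ^ n * q x) ^ 2 ∂μ ≤ K * (c₀ + 1) * ∫ x, x ^ (2 * (n + d)) ∂μ := by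
      calc _ ≤ ∫ x, K * (x ^ (2 * n) + x ^ (2 * (n + d))) ∂μ :=
            integral_mono (hL2 n).integrable_sq (hbi n) (hxb n)
        _ = K * ((∫ x, x ^ (2 * n) ∂μ) + ∫ x, x ^ (2 * (n + d)) ∂μ) := by
            rw [integral_const_mul, integral_add (hm _) (hm _)]
        _ ≤ K * (c₀ * (∫ x, x ^ (2 * (n + d)) ∂μ) + ∫ x, x ^ (2 * (n + d)) ∂μ) := by
            gcongr
            exact even_moment_le_mul_shift hm h0 d n
        _ = _ := by ring
    have h3 := Real.sqrt_le_sqrt h2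
    rw [Real.sqrt_mul (by positivity)] at h3
    have h4 : 0 < rootMoment μ (n + d) := rootMoment_pos hm h0 _
    simp only [mul_assoc] at h1
    calc _ ≤ _ := h1
      _ ≤ (√(K * (c₀ + 1)) * √(∫ x, x ^ (2 * (n + d)) ∂μ)) * √(∫ x, h x ^ 2 ∂μ) := by gcongr
      _ = c * rootMoment μ (n + d) := by rw [hc, rootMoment]; ring
      _ ≤ _ := by gcongr; linarith
  -- The Fourier transform of `q h μ` and its successive derivatives; at `t = 0` they are multiples
  -- of the vanishing moments.
  set F : ℕ → ℝ → ℂ := fun n t =>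
    ∫ x, Complex.exp (t * x * Complex.I) * ((x * Complex.I) ^ n * ((q x * h x : ℝ) : ℂ)) ∂μ with hF
  have hnorm : ∀ (n : ℕ) (t x : ℝ), ‖Complex.exp (t * x * Complex.I) *
      ((x * Complex.I) ^ n * ((q x * h x : ℝ) : ℂ))‖ = |x ^ n * (q x * h x)| := by
    intro n t x
    rw [norm_mul, ← Complex.ofReal_mul, Complex.norm_exp_ofReal_mul_I, one_mul, norm_mul, norm_pow,
      norm_mul, Complex.norm_I, mul_one, Complex.norm_real, Complex.norm_real, ← norm_pow,
      ← norm_mul, Real.norm_eq_abs]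
  have hqh : AEStronglyMeasurable (fun x => ((q x * h x : ℝ) : ℂ)) μ :=
    Complex.continuous_ofReal.comp_aestronglyMeasurable
      (hq.aestronglyMeasurable.mul hh.1)
  have hmeas : ∀ (n : ℕ) (t : ℝ), AEStronglyMeasurable (fun x : ℝ => Complex.exp (t * x * Complex.I) *
      ((x * Complex.I) ^ n * ((q x * h x : ℝ) : ℂ))) μ := fun n t =>
    (Continuous.aestronglyMeasurable (by fun_prop)).mul
      ((Continuous.aestronglyMeasurable (by fun_prop)).mul hqh)
  have hFi : ∀ (n : ℕ) (t : ℝ), Integrable (fun x : ℝ => Complex.exp (t * x * Complex.I) *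
      ((x * Complex.I) ^ n * ((q x * h x : ℝ) : ℂ))) μ := fun n t =>
    (hint n).norm.mono' (hmeas n t) (Eventually.of_forall fun x => by
      rw [hnorm, Real.norm_eq_abs])
  have hF0 : F 0 = 0 := by
    funext t
    refine bang (F := F) (M := fun n => (c + 1) * rootMoment μ (n + d))
      (fun n => mul_pos (by positivity) (rootMoment_pos hm h0 _)) ?_ ?_ ?_ ?_ ?_ t
    · intro a b hab
      have hc1 : c + 1 ≠ 0 := by positivity
      simp only [mul_div_mul_left _ _ hc1]
      have := rootMoment_ratio_monotone hm h0 (Nat.add_le_add_right hab d)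
      simpa [add_right_comm] using this
    · have hc1 : c + 1 ≠ 0 := by positivity
      simp only [mul_div_mul_left _ _ hc1]
      intro hs
      refine not_summable_rootMoment_ratio hm h0 hC ((summable_nat_add_iff d).1 ?_)
      simpa [add_right_comm] using hs
    · intro n t
      refine (hasDerivAt_integral_of_dominated_loc_of_deriv_le (μ := μ) (𝕜 := ℝ)
        (F := fun (t : ℝ) (x : ℝ) => Complex.exp (t * x * Complex.I) *
          ((x * Complex.I) ^ n * ((q x * h x : ℝ) : ℂ)))
        (F' := fun (t : ℝ) (x : ℝ) => Complex.exp (t * x * Complex.I) *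
          ((x * Complex.I) ^ (n + 1) * ((q x * h x : ℝ) : ℂ)))
        (bound := fun x => |x ^ (n + 1) * (q x * h x)|) (s := univ) univ_mem
        (Eventually.of_forall fun t => hmeas n t) (hFi n t) (hmeas (n + 1) t)
        (Eventually.of_forall fun x t _ => (hnorm (n + 1) t x).le) (hint (n + 1)).abs
        (Eventually.of_forall fun x t _ => ?_)).2
      have h1 : HasDerivAt (fun t : ℝ => (t : ℂ) * x * Complex.I) (x * Complex.I) t := by
        have := ((Complex.ofRealCLM.hasDerivAt (x := t)).mul_const (x : ℂ)).mul_const Complex.I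
        simpa using this
      refine (h1.cexp.mul_const ((x * Complex.I) ^ n * ((q x * h x : ℝ) : ℂ))).congr_deriv ?_
      ring
    · intro n t
      refine (norm_integral_le_integral_norm _).trans ?_
      simp only [hnorm]
      exact hbound n
    · intro n
      have : ∀ x : ℝ, Complex.exp ((0 : ℝ) * x * Complex.I) *
          ((x * Complex.I) ^ n * ((q x * h x : ℝ) : ℂ)) =
          Complex.I ^ n * ((x ^ n * (q x * h x) : ℝ) : ℂ) := by
        intro x
        push_cast
        simp
        ring
      simp only [hF, this]
      rw [integral_const_mul, integral_complex_ofReal, horth]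
      simp
  refine ae_eq_zero_of_integral_exp_eq_zero (by simpa using hint 0) fun t => ?_
  have := congrFun hF0 t
  simpa [hF] using this

end Moments

end MomentProblem

/-! ### Poisson integrals, and determinacy from density of polynomials -/

namespace MomentProblem

/-- Scaling replaces an explicit transform: with continuity at `0` it shows that the characteristic
function at a given `t` is nonzero for small `γ`, which is all that cancellation requires. -/
theorem charFun_cauchyMeasure_scale {γ : ℝ≥0} (hγ : γ ≠ 0) (t : ℝ) :
    charFun (ProbabilityTheory.cauchyMeasure 0 γ) t =
      charFun (ProbabilityTheory.cauchyMeasure 0 1) (γ * t) := by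
  have hγ' : (0 : ℝ) < γ := by positivity
  have key : ∀ (γ : ℝ≥0), γ ≠ 0 → ∀ t : ℝ,
      charFun (ProbabilityTheory.cauchyMeasure 0 γ) t =
        ∫ x : ℝ, ProbabilityTheory.cauchyPDFReal 0 γ x • Complex.exp (t * x * Complex.I) := by
    intro γ hγ t
    rw [charFun_apply_real, ProbabilityTheory.cauchyMeasure_of_scale_ne_zero 0 hγ,
      integral_withDensity_eq_integral_toReal_smul (ProbabilityTheory.measurable_cauchyPDF 0 γ)
        (Eventually.of_forall fun x => by simp [ProbabilityTheory.cauchyPDF])]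
    congr 1
    funext x
    rw [ProbabilityTheory.cauchyPDF, ENNReal.toReal_ofReal
      (ProbabilityTheory.cauchyPDF_pos 0 hγ x).le]
  rw [key γ hγ, key 1 one_ne_zero]
  have h1 := Measure.integral_comp_div (fun u : ℝ => ProbabilityTheory.cauchyPDFReal 0 1 u •
    Complex.exp (((γ : ℝ) * t : ℝ) * u * Complex.I)) (γ : ℝ)
  rw [abs_of_pos hγ'] at h1
  rw [← inv_smul_eq_iff₀ hγ'.ne'] at h1
  rw [← h1, ← integral_smul]
  congr 1
  funext x
  rw [smul_smul]
  congr 1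
  · rw [ProbabilityTheory.cauchyPDFReal_def, ProbabilityTheory.cauchyPDFReal_def]
    simp only [sub_zero, NNReal.coe_one]
    field_simp
  · congr 2
    push_cast
    have : (γ : ℂ) ≠ 0 := by exact_mod_cast hγ'.ne'
    field_simp

/-- A finite measure is determined by its Poisson integrals. -/
theorem measure_ext_of_integral_poisson {μ ν : Measure ℝ} [IsFiniteMeasure μ] [IsFiniteMeasure ν]
    (h : ∀ a b : ℝ, 0 < b → ∫ x, ((x - a) ^ 2 + b ^ 2)⁻¹ ∂μ = ∫ x, ((x - a) ^ 2 + b ^ 2)⁻¹ ∂ν) :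
    μ = ν := by
  have hlin : ∀ (ρ : Measure ℝ) [IsFiniteMeasure ρ] (γ : ℝ≥0), γ ≠ 0 → ∀ a : ℝ,
      ∫⁻ x, ProbabilityTheory.cauchyPDF 0 γ (-x + a) ∂ρ =
        ENNReal.ofReal (Real.pi⁻¹ * γ * ∫ x, ((x - a) ^ 2 + (γ : ℝ) ^ 2)⁻¹ ∂ρ) := by
    intro ρ _ γ hγ a
    have hγ' : (0 : ℝ) < γ := by positivity
    rw [← integral_const_mul, ofReal_integral_eq_lintegral_ofReal]
    · congr 1
      funext x
      rw [ProbabilityTheory.cauchyPDF, ProbabilityTheory.cauchyPDFReal_def]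
      congr 3
      ring
    · refine Integrable.const_mul ?_ _
      refine Integrable.of_bound (C := ((γ : ℝ) ^ 2)⁻¹)
        (Measurable.aestronglyMeasurable (by fun_prop)) (Eventually.of_forall fun x => ?_)
      rw [Real.norm_of_nonneg (by positivity)]
      gcongr
      nlinarith [sq_nonneg (x - a)]
    · exact Eventually.of_forall fun x => by positivity
  -- Up to a constant, the Poisson integral is the density of the convolution with a Cauchy law.
  have hconv : ∀ (ρ : Measure ℝ) [IsFiniteMeasure ρ] (γ : ℝ≥0), γ ≠ 0 → ∀ s : Set ℝ,
      MeasurableSet s → (ρ ∗ ProbabilityTheory.cauchyMeasure 0 γ) s =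
        ∫⁻ a, s.indicator 1 a * ∫⁻ x, ProbabilityTheory.cauchyPDF 0 γ (-x + a) ∂ρ := by
    intro ρ _ γ hγ s hs
    have hi : Measurable (s.indicator (1 : ℝ → ℝ≥0∞)) := measurable_one.indicator hs
    rw [← lintegral_indicator_one hs, Measure.lintegral_conv hi]
    have h1 : ∀ x, ∫⁻ y, s.indicator (1 : ℝ → ℝ≥0∞) (x + y) ∂ProbabilityTheory.cauchyMeasure 0 γ =
        ∫⁻ a, s.indicator 1 a * ProbabilityTheory.cauchyPDF 0 γ (-x + a) := by
      intro x
      rw [ProbabilityTheory.cauchyMeasure_of_scale_ne_zero 0 hγ,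
        lintegral_withDensity_eq_lintegral_mul _ (ProbabilityTheory.measurable_cauchyPDF 0 γ)
          (show Measurable fun y => s.indicator (1 : ℝ → ℝ≥0∞) (x + y) from
            hi.comp (measurable_const_add x)),
        ← lintegral_add_left_eq_self (fun a => s.indicator 1 a *
          ProbabilityTheory.cauchyPDF 0 γ (-x + a)) x]
      congr 1
      funext y
      simp [mul_comm]
    simp only [h1]
    rw [lintegral_lintegral_swap]
    · congr 1
      funext a
      rw [lintegral_const_mul _ (by fun_prop)]
    · exact ((hi.comp measurable_snd).mul (by fun_prop)).aemeasurable
  apply Measure.ext_of_charFun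
  funext t
  obtain ⟨γ, hγ, hne⟩ : ∃ γ : ℝ≥0, γ ≠ 0 ∧
      charFun (ProbabilityTheory.cauchyMeasure 0 γ) t ≠ 0 := by
    have hc : Continuous fun s : ℝ => charFun (ProbabilityTheory.cauchyMeasure 0 1) (s * t) :=
      continuous_charFun.comp (by fun_prop)
    have h0 : charFun (ProbabilityTheory.cauchyMeasure 0 1) ((0 : ℝ) * t) ≠ 0 := by
      simp [charFun_zero]
    have hev : ∀ᶠ s in 𝓝[>] (0 : ℝ),
        charFun (ProbabilityTheory.cauchyMeasure 0 1) (s * t) ≠ 0 :=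
      (hc.continuousAt.eventually_ne h0).filter_mono nhdsWithin_le_nhds
    obtain ⟨s, hs, hs0⟩ := (hev.and self_mem_nhdsWithin).exists
    have hs0 : 0 < s := hs0
    have hs1 : (⟨s, hs0.le⟩ : ℝ≥0) ≠ 0 := by
      intro h
      exact hs0.ne' (congrArg NNReal.toReal h)
    refine ⟨⟨s, hs0.le⟩, hs1, ?_⟩
    rw [charFun_cauchyMeasure_scale hs1]
    exact hs
  have heq : μ ∗ ProbabilityTheory.cauchyMeasure 0 γ = ν ∗ ProbabilityTheory.cauchyMeasure 0 γ := by
    ext s hs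
    rw [hconv μ γ hγ s hs, hconv ν γ hγ s hs]
    simp only [hlin μ γ hγ, hlin ν γ hγ, h _ _ (show (0 : ℝ) < γ by positivity)]
  have := congrArg (fun ρ => charFun ρ t) heq
  simp only [charFun_conv] at this
  exact mul_right_cancel₀ hne this

section

variable {μ ν : Measure ℝ}

theorem HasFiniteMoments.integrable_eval (hm : HasFiniteMoments μ) (p : Polynomial ℝ) :
    Integrable (fun x => p.eval x) μ := by
  simp only [Polynomial.eval_eq_sum_range]
  exact integrable_finsetSum _ fun i _ => (hm i).const_mul _

theorem HasFiniteMoments.memLp_eval (hm : HasFiniteMoments μ) (p : Polynomial ℝ) :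
    MemLp (fun x => p.eval x) 2 μ := by
  rw [memLp_two_iff_integrable_sq p.continuous.aestronglyMeasurable]
  exact (hm.integrable_eval (p ^ 2)).congr (ae_of_all _ fun x => Polynomial.eval_pow 2)

theorem SameMoments.integral_eval (h : SameMoments μ ν) (hm : HasFiniteMoments μ)
    (hn : HasFiniteMoments ν) (p : Polynomial ℝ) : ∫ x, p.eval x ∂ν = ∫ x, p.eval x ∂μ := by
  simp only [Polynomial.eval_eq_sum_range]
  rw [integral_finsetSum _ fun i _ => (hm i).const_mul _,
    integral_finsetSum _ fun i _ => (hn i).const_mul _]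
  simp only [integral_const_mul, h _]

/-- The linear map sending a polynomial to its class in `L²(μ)`. -/
noncomputable def evalLp (hm : HasFiniteMoments μ) : Polynomial ℝ →ₗ[ℝ] Lp ℝ 2 μ where
  toFun p := (hm.memLp_eval p).toLp _
  map_add' p q := by
    rw [← MemLp.toLp_add]
    simp only [Polynomial.eval_add]
    rfl
  map_smul' c p := by
    rw [RingHom.id_apply, ← MemLp.toLp_const_smul]
    simp only [Polynomial.eval_smul]
    rfl

theorem evalLp_ae (hm : HasFiniteMoments μ) (p : Polynomial ℝ) :
    evalLp hm p =ᵐ[μ] fun x => p.eval x := (hm.memLp_eval p).coeFn_toLp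

/-- The multiples of `q` have trivial orthogonal complement, hence are dense in `L²(μ)`; the
constant `1` is then approximated. -/
theorem exists_integral_one_sub_mul_sq_lt (hm : HasFiniteMoments μ) (q : Polynomial ℝ)
    (hq : ∀ h : ℝ → ℝ, MemLp h 2 μ → (∀ k : ℕ, ∫ x, x ^ k * (q.eval x * h x) ∂μ = 0) →
      h =ᵐ[μ] 0) {ε : ℝ} (hε : 0 < ε) :
    ∃ p : Polynomial ℝ, ∫ x, (1 - q * p : Polynomial ℝ).eval x ^ 2 ∂μ < ε := by
  set S : Submodule ℝ (Lp ℝ 2 μ) :=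
    LinearMap.range ((evalLp hm).comp (LinearMap.mulLeft ℝ q)) with hS
  have horth : Sᗮ = ⊥ := by
    rw [Submodule.eq_bot_iff]
    intro u hu
    rw [Submodule.mem_orthogonal] at hu
    have h0 : (u : ℝ → ℝ) =ᵐ[μ] 0 := by
      refine hq u (Lp.memLp u) fun k => ?_
      have h1 := hu (evalLp hm (q * Polynomial.X ^ k)) ⟨Polynomial.X ^ k, rfl⟩
      rw [L2.inner_def] at h1
      rw [← h1]
      refine integral_congr_ae ?_
      filter_upwards [evalLp_ae hm (q * Polynomial.X ^ k)] with x hx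
      rw [hx]
      simp
      ring
    exact (Lp.eq_zero_iff_ae_eq_zero).2 h0
  have hdense : S.topologicalClosure = ⊤ := (Submodule.topologicalClosure_eq_top_iff).2 horth
  have h1 : evalLp hm 1 ∈ closure (S : Set (Lp ℝ 2 μ)) := by
    rw [← Submodule.topologicalClosure_coe, hdense]; trivial
  obtain ⟨v, ⟨p, rfl⟩, hv⟩ := Metric.mem_closure_iff.1 h1 (√ε) (Real.sqrt_pos.2 hε)
  refine ⟨p, ?_⟩
  simp only [LinearMap.comp_apply, LinearMap.mulLeft_apply] at hv
  rw [dist_eq_norm, ← map_sub] at hv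
  have h2 : ‖evalLp hm (1 - q * p)‖ ^ 2 = ∫ x, (1 - q * p : Polynomial ℝ).eval x ^ 2 ∂μ := by
    rw [← real_inner_self_eq_norm_sq, L2.inner_def]
    refine integral_congr_ae ?_
    filter_upwards [evalLp_ae hm (1 - q * p)] with x hx
    rw [hx]
    simp [sq]
  rw [← h2]
  calc _ < √ε ^ 2 := by gcongr
    _ = ε := Real.sq_sqrt hε.le

/-- Sufficient condition for determinacy in terms of orthogonality to multiples of
`(x - a)² + b²`. -/
theorem mdet_of_orthogonal [IsProbabilityMeasure μ] (hm : HasFiniteMoments μ)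
    (H : ∀ a b : ℝ, 0 < b → ∀ h : ℝ → ℝ, MemLp h 2 μ →
      (∀ k : ℕ, ∫ x, x ^ k * (((x - a) ^ 2 + b ^ 2) * h x) ∂μ = 0) → h =ᵐ[μ] 0) : MDet μ := by
  refine ⟨hm, fun ν _ hn hs => ?_⟩
  refine measure_ext_of_integral_poisson fun a b hb => ?_
  set q : Polynomial ℝ := (Polynomial.X - Polynomial.C a) ^ 2 + Polynomial.C (b ^ 2) with hqdef
  have hqe : ∀ x, q.eval x = (x - a) ^ 2 + b ^ 2 := fun x => by simp [hqdef]
  have hqpos : ∀ x, b ^ 2 ≤ q.eval x := fun x => by rw [hqe]; nlinarith [sq_nonneg (x - a)]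
  have hb2 : 0 < b ^ 2 := by positivity
  simp only [← hqe]
  -- `1/q - p = (1 - q p)/q` with `1/q ≤ b⁻²`, so Cauchy–Schwarz bounds the error by the integral of
  -- a polynomial, which is the same for `μ` and `ν`.
  have hinv : ∀ (ρ : Measure ℝ) [IsProbabilityMeasure ρ], HasFiniteMoments ρ →
      ∀ p : Polynomial ℝ, |∫ x, (q.eval x)⁻¹ ∂ρ - ∫ x, p.eval x ∂ρ| ≤
        (b ^ 2)⁻¹ * √(∫ x, (1 - q * p : Polynomial ℝ).eval x ^ 2 ∂ρ) := by
    intro ρ _ hρ p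
    have hi : Integrable (fun x => (q.eval x)⁻¹) ρ := by
      refine Integrable.of_bound (C := (b ^ 2)⁻¹)
        (Measurable.aestronglyMeasurable q.continuous.measurable.inv)
        (Eventually.of_forall fun x => ?_)
      rw [Real.norm_of_nonneg (inv_nonneg.2 (hb2.le.trans (hqpos x)))]
      exact inv_anti₀ hb2 (hqpos x)
    rw [← integral_sub hi (hρ.integrable_eval p)]
    have hcs := integral_abs_mul_le_sqrt_mul_sqrt (hρ.memLp_eval (1 - q * p))
      (hρ.memLp_eval 1)
    simp only [Polynomial.eval_one, mul_one, one_pow, integral_const, probReal_univ,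
      smul_eq_mul, Real.sqrt_one] at hcs
    calc _ ≤ ∫ x, |(q.eval x)⁻¹ - p.eval x| ∂ρ := abs_integral_le_integral_abs
      _ ≤ ∫ x, (b ^ 2)⁻¹ * |(1 - q * p : Polynomial ℝ).eval x| ∂ρ := by
        refine integral_mono (hi.sub (hρ.integrable_eval p)).abs
          ((hρ.integrable_eval _).abs.const_mul _) fun x => ?_
        have hx : 0 < q.eval x := hb2.trans_le (hqpos x)
        have : (q.eval x)⁻¹ - p.eval x = (q.eval x)⁻¹ * (1 - q * p : Polynomial ℝ).eval x := by
          simp only [Polynomial.eval_sub, Polynomial.eval_mul, Polynomial.eval_one]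
          field_simp
        simp only
        rw [this, abs_mul, abs_of_pos (inv_pos.2 hx)]
        exact mul_le_mul_of_nonneg_right (inv_anti₀ hb2 (hqpos x)) (abs_nonneg _)
      _ ≤ _ := by
        rw [integral_const_mul]
        gcongr
  rw [← sub_eq_zero, ← abs_nonpos_iff]
  refine le_of_forall_pos_lt_add fun ε hε => ?_
  obtain ⟨p, hp⟩ := exists_integral_one_sub_mul_sq_lt hm q
    (fun h hh hk => H a b hb h hh (by simpa only [hqe] using hk))
    (ε := (ε * b ^ 2 / 2) ^ 2) (by positivity)
  have h1 := hinv μ hm p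
  have h2 := hinv ν hn p
  have h3 : ∫ x, (1 - q * p : Polynomial ℝ).eval x ^ 2 ∂ν =
      ∫ x, (1 - q * p : Polynomial ℝ).eval x ^ 2 ∂μ := by
    have h := hs.integral_eval hm hn ((1 - q * p) ^ 2)
    have h5 : ∀ x, ((1 - q * p) ^ 2 : Polynomial ℝ).eval x =
      (1 - q * p : Polynomial ℝ).eval x ^ 2 := fun x => Polynomial.eval_pow 2
    rw [integral_congr_ae (ae_of_all _ h5), integral_congr_ae (ae_of_all _ h5)] at h
    exact h
  rw [h3, hs.integral_eval hm hn p] at h2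
  have h4 : (b ^ 2)⁻¹ * √(∫ x, (1 - q * p : Polynomial ℝ).eval x ^ 2 ∂μ) < ε / 2 := by
    have : √(∫ x, (1 - q * p : Polynomial ℝ).eval x ^ 2 ∂μ) < ε * b ^ 2 / 2 :=
      (Real.sqrt_lt' (by positivity)).2 hp
    calc _ < (b ^ 2)⁻¹ * (ε * b ^ 2 / 2) := by gcongr
      _ = ε / 2 := by field_simp
  rw [zero_add]
  rw [abs_le] at h1 h2
  rw [abs_lt]
  constructor <;> linarith

/-- A bound for the squares of the polynomials used as multipliers. -/
theorem sq_sub_add_sq_sq_le (a b y : ℝ) :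
    ((y - a) ^ 2 + b ^ 2) ^ 2 ≤ (16 * (1 + a ^ 2 + b ^ 2) ^ 2) * (1 + y ^ 4) := by
  have h1 : (y - a) ^ 2 + b ^ 2 ≤ 2 * (1 + a ^ 2 + b ^ 2) * (1 + y ^ 2) := by
    nlinarith [sq_nonneg (y + a), sq_nonneg (a * y), sq_nonneg (b * y), sq_nonneg b]
  have h2 : (1 + y ^ 2) ^ 2 ≤ 4 * (1 + y ^ 4) := by nlinarith [sq_nonneg (y ^ 2 - 1)]
  calc _ ≤ (2 * (1 + a ^ 2 + b ^ 2) * (1 + y ^ 2)) ^ 2 := by gcongr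
    _ = 4 * (1 + a ^ 2 + b ^ 2) ^ 2 * (1 + y ^ 2) ^ 2 := by ring
    _ ≤ 4 * (1 + a ^ 2 + b ^ 2) ^ 2 * (4 * (1 + y ^ 4)) := by gcongr
    _ = _ := by ring

theorem CarlemanCondition.mdet [IsProbabilityMeasure μ] (hC : CarlemanCondition μ)
    (hm : HasFiniteMoments μ) (h0 : μ {0}ᶜ ≠ 0) : MDet μ := by
  refine mdet_of_orthogonal hm fun a b hb h hh hk => ?_
  have := hC.ae_eq_zero_of_orthogonal hm h0 hh (q := fun x => (x - a) ^ 2 + b ^ 2)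
    (by fun_prop) (d := 2) (fun x => sq_sub_add_sq_sq_le a b x) hk
  filter_upwards [this] with x hx
  have : 0 < (x - a) ^ 2 + b ^ 2 := by positivity
  simpa [this.ne'] using hx

theorem HasFiniteMoments.map_sq (hm : HasFiniteMoments μ) :
    HasFiniteMoments (μ.map (fun x => x ^ 2)) := by
  intro k
  rw [integrable_map_measure (by fun_prop) (by fun_prop)]
  simpa [Function.comp_def, ← pow_mul] using hm (2 * k)

/-- The square of a symmetric random variable satisfying Carleman's condition is determinate,
even in the sense of Hamburger. -/
theorem CarlemanCondition.mdet_map_sq [IsProbabilityMeasure μ] (hC : CarlemanCondition μ)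
    (hm : HasFiniteMoments μ) (h0 : μ {0}ᶜ ≠ 0) (hsymm : μ.map (fun x => -x) = μ) :
    MDet (μ.map (fun x => x ^ 2)) := by
  have hsq : Measurable fun x : ℝ => x ^ 2 := by fun_prop
  have : IsProbabilityMeasure (μ.map (fun x => x ^ 2)) :=
    Measure.isProbabilityMeasure_map hsq.aemeasurable
  refine mdet_of_orthogonal hm.map_sq fun a b hb h hh hk => ?_
  have hh' : MemLp (fun x => h (x ^ 2)) 2 μ := hh.comp_of_map hsq.aemeasurable
  have hmeas : AEStronglyMeasurable h (μ.map (fun x => x ^ 2)) := hh.1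
  -- Carleman's condition is used for `μ`, not for its image: even powers give the assumed
  -- orthogonality, odd powers integrate to zero by symmetry.
  have key := hC.ae_eq_zero_of_orthogonal hm h0 hh' (q := fun x => (x ^ 2 - a) ^ 2 + b ^ 2)
    (by fun_prop) (d := 4) (K := 16 * (1 + a ^ 2 + b ^ 2) ^ 2) (fun x => by
      have := sq_sub_add_sq_sq_le a b (x ^ 2)
      rwa [← pow_mul x 2 4] at this) (fun k => by
      rcases Nat.even_or_odd' k with ⟨j, rfl | rfl⟩
      · have h1 := hk j
        have h2 : AEStronglyMeasurable (fun x : ℝ => x ^ j * (((x - a) ^ 2 + b ^ 2) * h x))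
            (μ.map (fun x => x ^ 2)) :=
          (Continuous.aestronglyMeasurable (by fun_prop)).mul
            ((Continuous.aestronglyMeasurable (by fun_prop)).mul hmeas)
        rw [integral_map hsq.aemeasurable h2] at h1
        simpa only [← pow_mul] using h1
      · have h2 : ∫ x, x ^ (2 * j + 1) * (((x ^ 2 - a) ^ 2 + b ^ 2) * h (x ^ 2)) ∂μ =
            ∫ x, x ^ (2 * j + 1) * (((x ^ 2 - a) ^ 2 + b ^ 2) * h (x ^ 2))
              ∂(μ.map (fun x => -x)) := by rw [hsymm]
        rw [integral_map measurable_neg.aemeasurable (by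
          rw [hsymm]
          exact (Continuous.aestronglyMeasurable (by fun_prop)).mul
            ((Continuous.aestronglyMeasurable (by fun_prop)).mul hh'.1))] at h2
        have h3 : ∀ x : ℝ, (-x) ^ (2 * j + 1) * ((((-x) ^ 2 - a) ^ 2 + b ^ 2) * h ((-x) ^ 2)) =
            -(x ^ (2 * j + 1) * (((x ^ 2 - a) ^ 2 + b ^ 2) * h (x ^ 2))) := by
          intro x
          rw [Odd.neg_pow ⟨j, rfl⟩, neg_sq]
          ring
        simp only [h3] at h2
        rw [integral_neg] at h2
        linarith)
  have h1 : ∀ᵐ x ∂μ, h (x ^ 2) = 0 := by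
    filter_upwards [key] with x hx
    have : 0 < (x ^ 2 - a) ^ 2 + b ^ 2 := by positivity
    simpa [this.ne'] using hx
  have h2 : ∀ᵐ x ∂μ, hmeas.mk h (x ^ 2) = 0 := by
    filter_upwards [h1, ae_of_ae_map hsq.aemeasurable hmeas.ae_eq_mk] with x hx hx'
    rw [← hx', hx]
  have h3 : ∀ᵐ y ∂(μ.map (fun x => x ^ 2)), hmeas.mk h y = 0 :=
    (ae_map_iff hsq.aemeasurable
      (hmeas.stronglyMeasurable_mk.measurable (measurableSet_singleton 0))).2 h2
  filter_upwards [h3, hmeas.ae_eq_mk] with y hy hy'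
  rw [hy', hy]; rfl

end

end MomentProblem

/-! ### Condition L: from a divergent Krein integral to Carleman's condition -/

namespace MomentProblem

theorem lintegral_Ioi_inv_sq {c : ℝ} (hc : 0 < c) :
    ∫⁻ x in Ioi c, ENNReal.ofReal ((x ^ 2)⁻¹) = ENNReal.ofReal c⁻¹ := by
  have h1 : ∀ x ∈ Ioi c, (x ^ 2)⁻¹ = x ^ (-2 : ℝ) := fun x hx => by
    rw [Real.rpow_neg (hc.trans hx).le, Real.rpow_two]
  have h2 : IntegrableOn (fun x : ℝ => (x ^ 2)⁻¹) (Ioi c) :=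
    (integrableOn_Ioi_rpow_of_lt (by norm_num : (-2 : ℝ) < -1) hc).congr_fun
      (fun x hx => (h1 x hx).symm) measurableSet_Ioi
  rw [← ofReal_integral_eq_lintegral_ofReal h2 (Eventually.of_forall fun x => by positivity),
    setIntegral_congr_fun measurableSet_Ioi h1,
    integral_Ioi_rpow_of_lt (by norm_num : (-2 : ℝ) < -1) hc]
  congr 1
  norm_num
  rw [Real.rpow_neg_one]

theorem setLIntegral_le_abs_le {g : ℝ → ℝ≥0∞} (hg : ∀ x, g (-x) = g x) {c : ℝ} :
    ∫⁻ x in {x : ℝ | c ≤ |x|}, g x ≤ 2 * ∫⁻ x in Ioi c, g x := by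
  have h1 : {x : ℝ | c ≤ |x|} ⊆ Ici c ∪ Iic (-c) := by
    intro x hx
    rcases le_abs.1 (show c ≤ |x| from hx) with h | h
    · exact Or.inl h
    · exact Or.inr (show x ≤ -c by linarith)
  have h2 : ∫⁻ x in Iic (-c), g x = ∫⁻ x in Ici c, g x := by
    have := (Measure.measurePreserving_neg (volume : Measure ℝ)).setLIntegral_comp_preimage_emb
      (MeasurableEquiv.neg ℝ).measurableEmbedding g (Iic (-c))
    rw [← this]
    simp [hg]
  calc _ ≤ ∫⁻ x in Ici c ∪ Iic (-c), g x := lintegral_mono_set h1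
    _ ≤ (∫⁻ x in Ici c, g x) + ∫⁻ x in Iic (-c), g x := lintegral_union_le _ _ _
    _ = _ := by rw [h2, two_mul, setLIntegral_congr Ioi_ae_eq_Ici]

/-- The logarithmic slope `L_f`. -/
noncomputable def logSlope (f : ℝ → ℝ) (x : ℝ) : ℝ := -(x * deriv f x) / f x

/-- Beyond `a`, the function `f` is positive, at most one, and its logarithmic slope is monotone
and at least one. -/
structure RegularTail (f : ℝ → ℝ) (a : ℝ) : Prop where
  one_le : 1 ≤ a
  pos : ∀ x, a ≤ x → 0 < f x
  le_one : ∀ x, a ≤ x → f x ≤ 1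
  hasDerivAt : ∀ x, a ≤ x → HasDerivAt (fun x => -Real.log (f x)) (logSlope f x / x) x
  monotoneOn : MonotoneOn (logSlope f) (Ici a)
  one_le_slope : ∀ x, a ≤ x → 1 ≤ logSlope f x

/-- `-log f - m log x` has derivative `(L_f - m) / x ≥ 0`. -/
theorem mul_pow_le_of_slope {f : ℝ → ℝ} {y : ℝ} (hy : 0 < y) (hpos : ∀ x, y ≤ x → 0 < f x)
    (hd : ∀ x, y ≤ x → HasDerivAt (fun x => -Real.log (f x)) (logSlope f x / x) x) {m : ℕ}
    (hm : ∀ x, y ≤ x → (m : ℝ) ≤ logSlope f x) {x : ℝ} (hx : y ≤ x) :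
    f x * x ^ m ≤ f y * y ^ m := by
  have hder : ∀ x, y ≤ x → HasDerivAt (fun x => -Real.log (f x) - m * Real.log x)
      (logSlope f x / x - m * x⁻¹) x := fun x hx =>
    (hd x hx).sub ((Real.hasDerivAt_log (hy.trans_le hx).ne').const_mul _)
  have hmono : MonotoneOn (fun x => -Real.log (f x) - m * Real.log x) (Ici y) := by
    refine monotoneOn_of_deriv_nonneg (convex_Ici y)
      (fun x hx => (hder x hx).continuousAt.continuousWithinAt)
      (fun x hx => (hder x (interior_subset hx)).differentiableAt.differentiableWithinAt)
      fun x hx => ?_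
    have hx' : y ≤ x := interior_subset hx
    rw [(hder x hx').deriv, ← div_eq_mul_inv, ← sub_div]
    exact div_nonneg (sub_nonneg.2 (hm x hx')) (hy.trans_le hx').le
  have h1 := hmono self_mem_Ici (show x ∈ Ici y from hx) hx
  simp only at h1
  have hx0 := hy.trans_le hx
  rw [← Real.log_le_log_iff (mul_pos (hpos x hx) (pow_pos hx0 m))
    (mul_pos (hpos y le_rfl) (pow_pos hy m)), Real.log_mul (hpos x hx).ne' (pow_pos hx0 m).ne',
    Real.log_mul (hpos y le_rfl).ne' (pow_pos hy m).ne', Real.log_pow, Real.log_pow]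
  linarith

theorem RegularTail.mono {f : ℝ → ℝ} {a b : ℝ} (h : RegularTail f a) (hab : a ≤ b) :
    RegularTail f b :=
  ⟨h.one_le.trans hab, fun x hx => h.pos x (hab.trans hx), fun x hx => h.le_one x (hab.trans hx),
    fun x hx => h.hasDerivAt x (hab.trans hx), h.monotoneOn.mono (Ici_subset_Ici.2 hab),
    fun x hx => h.one_le_slope x (hab.trans hx)⟩

theorem ConditionL.exists_regularTail {f : ℝ → ℝ} (hL : ConditionL f) :
    ∃ a, RegularTail f a ∧ Tendsto (logSlope f) atTop atTop := by
  obtain ⟨-, x₀, hx₀, hpos, hdiff, hmono, hlim⟩ := hL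
  have hlim' : Tendsto (logSlope f) atTop atTop := hlim
  obtain ⟨b, hb⟩ := eventually_atTop.1 (hlim'.eventually_ge_atTop 1)
  set c := max (max (x₀ + 1) 1) b with hc
  have hc0 : x₀ + 1 ≤ c := (le_max_left _ _).trans (le_max_left _ _)
  have hc1 : 1 ≤ c := (le_max_right _ _).trans (le_max_left _ _)
  have hcb : b ≤ c := le_max_right _ _
  have hmem : ∀ x, c ≤ x → x ∈ Ioi x₀ := fun x hx => by simp only [mem_Ioi]; linarith
  have hder : ∀ x, c ≤ x → HasDerivAt (fun x => -Real.log (f x)) (logSlope f x / x) x := by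
    intro x hx
    have hfx := hpos x (hmem x hx)
    have h1 : HasDerivAt f (deriv f x) x :=
      (hdiff.differentiableAt (Ioi_mem_nhds (hmem x hx))).hasDerivAt
    refine (h1.log hfx.ne').neg.congr_deriv ?_
    have hx0 : x ≠ 0 := by linarith
    rw [logSlope]
    field_simp
  have hslope : ∀ x, c ≤ x → 1 ≤ logSlope f x := fun x hx => hb x (hcb.trans hx)
  -- Slope at least one gives `f x * x ≤ f c * c`, so `f ≤ 1` as soon as `x ≥ f c * c`.
  refine ⟨max c (f c * c), ⟨hc1.trans (le_max_left _ _),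
    fun x hx => hpos x (hmem x ((le_max_left _ _).trans hx)), fun x hx => ?_,
    fun x hx => hder x ((le_max_left _ _).trans hx),
    hmono.mono fun x hx => hmem x ((le_max_left _ _).trans hx),
    fun x hx => hslope x ((le_max_left _ _).trans hx)⟩, hlim'⟩
  have hcx := (le_max_left _ _).trans hx
  have h2 := mul_pow_le_of_slope (m := 1) (by linarith : 0 < c) (fun x hx => hpos x (hmem x hx)) hder
    (by simpa using hslope) hcx
  simp only [pow_one] at h2
  have h3 := h2.trans ((le_max_right _ _).trans hx)
  have hx0 : 0 < x := by linarith
  exact (mul_le_iff_le_one_left hx0).1 h3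

section Krein

variable {f : ℝ → ℝ} {μ : Measure ℝ}

theorem log_ofReal_toENNReal_le (y : ℝ) :
    (ENNReal.log (ENNReal.ofReal y)).toENNReal ≤ ENNReal.ofReal y := by
  rcases le_or_gt y 0 with hy | hy
  · simp [ENNReal.ofReal_of_nonpos hy]
  · rw [ENNReal.log_ofReal_of_pos hy, EReal.toENNReal_of_ne_top (EReal.coe_ne_top _),
      EReal.toReal_coe]
    exact ENNReal.ofReal_le_ofReal (Real.log_le_self hy.le)

theorem IsDensity.lintegral_eq_one [IsProbabilityMeasure μ] (hf : IsDensity f μ) :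
    ∫⁻ x, ENNReal.ofReal (f x) = 1 := by
  have := measure_univ (μ := μ)
  rwa [hf.eq_withDensity, withDensity_apply _ MeasurableSet.univ, setLIntegral_univ] at this

/-- Since `log⁺ f ≤ f`, the subtracted integral is at most one and cannot compensate an infinite
first one. -/
theorem kreinIntegral_lt_top_iff [IsProbabilityMeasure μ] (hf : IsDensity f μ) (c : ℝ) :
    kreinIntegral f c < ⊤ ↔ ∫⁻ x in {x : ℝ | c ≤ |x|},
      (-ENNReal.log (ENNReal.ofReal (f x))).toENNReal / ENNReal.ofReal (1 + x ^ 2) ≠ ⊤ := by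
  have hB : ∫⁻ x in {x : ℝ | c ≤ |x|},
      (ENNReal.log (ENNReal.ofReal (f x))).toENNReal / ENNReal.ofReal (1 + x ^ 2) ≠ ⊤ := by
    refine ne_top_of_le_ne_top (b := 1) ENNReal.one_ne_top ?_
    rw [← hf.lintegral_eq_one]
    refine (setLIntegral_le_lintegral _ _).trans (lintegral_mono fun x => ?_)
    refine (ENNReal.div_le_of_le_mul ?_)
    refine (log_ofReal_toENNReal_le _).trans (le_mul_of_one_le_right' ?_)
    rw [ENNReal.one_le_ofReal]
    nlinarith [sq_nonneg x]
  rw [kreinIntegral]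
  generalize ∫⁻ x in {x : ℝ | c ≤ |x|},
      (ENNReal.log (ENNReal.ofReal (f x))).toENNReal / ENNReal.ofReal (1 + x ^ 2) = B at *
  generalize ∫⁻ x in {x : ℝ | c ≤ |x|},
      (-ENNReal.log (ENNReal.ofReal (f x))).toENNReal / ENNReal.ofReal (1 + x ^ 2) = A
  lift B to ℝ≥0 using hB
  constructor
  · rintro h rfl
    simp at h
  · intro h
    lift A to ℝ≥0 using h
    have : (((A : ℝ≥0∞) : EReal) - ((B : ℝ≥0∞) : EReal)) = (((A : ℝ) - (B : ℝ) : ℝ) : EReal) := by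
      rw [EReal.coe_sub]; rfl
    rw [this]
    exact EReal.coe_lt_top _

theorem neg_log_ofReal_toENNReal {y : ℝ} (hy : 0 < y) :
    (-ENNReal.log (ENNReal.ofReal y)).toENNReal = ENNReal.ofReal (-Real.log y) := by
  rw [ENNReal.log_ofReal_of_pos hy, ← EReal.coe_neg, EReal.toENNReal_of_ne_top (EReal.coe_ne_top _),
    EReal.toReal_coe]

theorem kreinIntegral_lt_top_of_integrableOn [IsProbabilityMeasure μ] (hf : IsDensity f μ)
    (hsymm : ∀ x, f (-x) = f x) {a : ℝ} (ha : RegularTail f a)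
    (hi : IntegrableOn (fun x => -Real.log (f x) / x ^ 2) (Ioi a)) : kreinIntegral f a < ⊤ := by
  rw [kreinIntegral_lt_top_iff hf]
  refine ne_top_of_le_ne_top ?_ (setLIntegral_le_abs_le fun x => by simp [hsymm])
  refine ENNReal.mul_ne_top ENNReal.ofNat_ne_top ?_
  refine ne_top_of_le_ne_top hi.lintegral_lt_top.ne (setLIntegral_mono' measurableSet_Ioi fun x hx => ?_)
  have hx0 : 0 < x := by linarith [ha.one_le, show a < x from hx]
  rw [neg_log_ofReal_toENNReal (ha.pos x (le_of_lt hx)), ← ENNReal.ofReal_div_of_pos (by positivity)]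
  refine ENNReal.ofReal_le_ofReal ?_
  have : 0 ≤ -Real.log (f x) := by
    have := Real.log_nonpos (ha.pos x (le_of_lt hx)).le (ha.le_one x (le_of_lt hx))
    linarith
  gcongr
  linarith

theorem integrableOn_of_kreinIntegral_lt_top [IsProbabilityMeasure μ] (hf : IsDensity f μ)
    {a c : ℝ} (ha : RegularTail f a) (hca : c ≤ a) (hK : kreinIntegral f c < ⊤) :
    IntegrableOn (fun x => -Real.log (f x) / x ^ 2) (Ioi a) := by
  rw [kreinIntegral_lt_top_iff hf] at hK
  refine ⟨((hf.measurable.log.neg).div (by fun_prop)).aestronglyMeasurable, ?_⟩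
  rw [hasFiniteIntegral_iff_norm]
  have h1 : ∫⁻ x in Ioi a, ENNReal.ofReal ‖-Real.log (f x) / x ^ 2‖ ≤
      2 * ∫⁻ x in {x : ℝ | c ≤ |x|},
      (-ENNReal.log (ENNReal.ofReal (f x))).toENNReal / ENNReal.ofReal (1 + x ^ 2) := by
    rw [← lintegral_const_mul' _ _ ENNReal.ofNat_ne_top]
    refine (setLIntegral_mono' measurableSet_Ioi fun x hx => ?_).trans (lintegral_mono_set ?_)
    · have hx1 : 1 < x := by linarith [ha.one_le, show a < x from hx]
      rw [neg_log_ofReal_toENNReal (ha.pos x (le_of_lt hx)),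
        ← ENNReal.ofReal_div_of_pos (by positivity),
        show (2 : ℝ≥0∞) = ENNReal.ofReal 2 by simp, ← ENNReal.ofReal_mul (by norm_num)]
      refine ENNReal.ofReal_le_ofReal ?_
      have : 0 ≤ -Real.log (f x) := by
        have := Real.log_nonpos (ha.pos x (le_of_lt hx)).le (ha.le_one x (le_of_lt hx))
        linarith
      rw [Real.norm_of_nonneg (by positivity), ← mul_div_assoc,
        div_le_div_iff₀ (by positivity) (by positivity)]
      have : 1 ≤ x ^ 2 := by nlinarith
      nlinarith
    · intro x hx
      exact (hca.trans (le_of_lt hx)).trans (le_abs_self x)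
  exact h1.trans_lt (ENNReal.mul_lt_top (by simp) (lt_top_iff_ne_top.2 hK))

end Krein

section Carleman

variable {f : ℝ → ℝ} {μ : Measure ℝ}

theorem RegularTail.monotoneOn_neg_log {a : ℝ} (ha : RegularTail f a) :
    MonotoneOn (fun x => -Real.log (f x)) (Ici a) := by
  refine monotoneOn_of_deriv_nonneg (convex_Ici a)
      (fun x hx => (ha.hasDerivAt x hx).continuousAt.continuousWithinAt)
      (fun x hx => (ha.hasDerivAt x (interior_subset hx)).differentiableAt.differentiableWithinAt)
      fun x hx => ?_
  have hx' : a ≤ x := interior_subset hx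
  have := ha.one_le_slope x hx'
  have := ha.one_le
  rw [(ha.hasDerivAt x hx').deriv]
  exact div_nonneg (by linarith) (by linarith)

theorem RegularTail.neg_log_nonneg {a : ℝ} (ha : RegularTail f a) {x : ℝ} (hx : a ≤ x) :
    0 ≤ -Real.log (f x) := by
  have := Real.log_nonpos (ha.pos x hx).le (ha.le_one x hx)
  linarith

/-- Integration by parts: integrability of `L_f(x) / x²` implies that of `-log f(x) / x²`. -/
theorem RegularTail.integrableOn_neg_log {a : ℝ} (ha : RegularTail f a)
    (hi : IntegrableOn (fun x => logSlope f x / x ^ 2) (Ioi a)) :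
    IntegrableOn (fun x => -Real.log (f x) / x ^ 2) (Ioi a) := by
  have ha1 := ha.one_le
  have hcont : ContinuousOn (fun x => -Real.log (f x) / x ^ 2) (Ici a) := by
    refine ContinuousOn.div (fun x hx => (ha.hasDerivAt x hx).continuousAt.continuousWithinAt)
      (by fun_prop) fun x hx => ?_
    have : 0 < x := by linarith [show a ≤ x from hx]
    positivity
  have hloc : ∀ R, a ≤ R → IntervalIntegrable (fun x => -Real.log (f x) / x ^ 2) volume a R :=
    fun R hR => (hcont.mono (by rw [uIcc_of_le hR]; exact Icc_subset_Ici_self)).intervalIntegrable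
  have hlocL : ∀ R, a ≤ R → IntervalIntegrable (fun x => logSlope f x / x ^ 2) volume a R :=
    fun R hR => (intervalIntegrable_iff_integrableOn_Ioc_of_le hR).2
      (hi.mono_set Ioc_subset_Ioi_self)
  refine integrableOn_Ioi_of_intervalIntegral_norm_bounded
    ((∫ x in Ioi a, logSlope f x / x ^ 2) + -Real.log (f a) / a) a (l := atTop) (b := id)
    (fun R => ?_) tendsto_id ?_
  · rcases le_total a R with hR | hR
    · exact (intervalIntegrable_iff_integrableOn_Ioc_of_le hR).1 (hloc R hR)
    · simp [Ioc_eq_empty (not_lt.2 hR)]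
  · filter_upwards [eventually_ge_atTop a] with R hR
    simp only [id]
    have h1 : ∫ x in a..R, ‖-Real.log (f x) / x ^ 2‖ = ∫ x in a..R, -Real.log (f x) / x ^ 2 := by
      refine intervalIntegral.integral_congr fun x hx => ?_
      rw [uIcc_of_le hR] at hx
      exact Real.norm_of_nonneg (div_nonneg (ha.neg_log_nonneg hx.1) (sq_nonneg x))
    -- The boundary term at `R` is nonnegative and can be dropped, so the bound is uniform in `R`.
    have hder : ∀ x ∈ uIcc a R, HasDerivAt (fun x => -Real.log (f x) / x)
        (logSlope f x / x ^ 2 - -Real.log (f x) / x ^ 2) x := by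
      intro x hx
      rw [uIcc_of_le hR] at hx
      have hx0 : x ≠ 0 := by linarith [hx.1]
      refine ((ha.hasDerivAt x hx.1).div (hasDerivAt_id x) hx0).congr_deriv ?_
      simp only [id]
      field_simp
    have h2 := intervalIntegral.integral_eq_sub_of_hasDerivAt hder ((hlocL R hR).sub (hloc R hR))
    rw [intervalIntegral.integral_sub (hlocL R hR) (hloc R hR)] at h2
    have h3 : ∫ x in a..R, logSlope f x / x ^ 2 ≤ ∫ x in Ioi a, logSlope f x / x ^ 2 := by
      rw [intervalIntegral.integral_of_le hR]
      refine setIntegral_mono_set hi ?_ Ioc_subset_Ioi_self.eventuallyLE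
      filter_upwards [ae_restrict_mem measurableSet_Ioi] with x hx
      have := ha.one_le_slope x (le_of_lt hx)
      exact div_nonneg (by linarith) (sq_nonneg x)
    have h4 : 0 ≤ -Real.log (f R) / R := div_nonneg (ha.neg_log_nonneg hR) (by linarith)
    rw [h1]
    linarith

/-- Split at `|x| = y`. Outside, slope at least `2n + 2` gives `f(x) x^(2n) ≤ f(y) y^(2n+2) x⁻²`,
which integrates to `f(y) y^(2n+1)`; and `f(y) y ≤ f(a) a` frees the constant from `n` and `y`. -/
theorem ofReal_even_moment_le [IsProbabilityMeasure μ] (hf : IsDensity f μ)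
    (hm : HasFiniteMoments μ) (hsymm : ∀ x, f (-x) = f x) {a : ℝ} (ha : RegularTail f a) {n : ℕ}
    {y : ℝ} (hay : a ≤ y) (hy : ∀ x, y ≤ x → (2 * n + 2 : ℕ) ≤ logSlope f x) :
    ENNReal.ofReal (∫ x, x ^ (2 * n) ∂μ) ≤
      ENNReal.ofReal ((1 + 2 * (f a * a)) * y ^ (2 * n)) := by
  have ha1 := ha.one_le
  have hy0 : 0 < y := by linarith
  have hfa := ha.pos a le_rfl
  have hmeas : Measurable fun x : ℝ => ENNReal.ofReal (x ^ (2 * n)) := by fun_prop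
  rw [ofReal_integral_eq_lintegral_ofReal (hm _)
    (Eventually.of_forall fun x => by simp only [Pi.zero_apply]; rw [pow_mul]; positivity)]
  have hsplit := lintegral_add_compl (μ := μ) (fun x : ℝ => ENNReal.ofReal (x ^ (2 * n)))
    (measurableSet_le measurable_const measurable_norm : MeasurableSet {x : ℝ | y ≤ ‖x‖})
  rw [← hsplit]
  have h1 : ∫⁻ x in {x : ℝ | y ≤ ‖x‖}ᶜ, ENNReal.ofReal (x ^ (2 * n)) ∂μ ≤
      ENNReal.ofReal (y ^ (2 * n)) := by
    calc _ ≤ ∫⁻ x in {x : ℝ | y ≤ ‖x‖}ᶜ, ENNReal.ofReal (y ^ (2 * n)) ∂μ := by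
          refine setLIntegral_mono' (measurableSet_le measurable_const measurable_norm).compl
            fun x hx => ENNReal.ofReal_le_ofReal ?_
          have hx' : |x| ≤ y := by
            have : ‖x‖ < y := by simpa using hx
            exact this.le
          rw [pow_mul, pow_mul]
          exact pow_le_pow_left₀ (sq_nonneg x) (sq_le_sq' (abs_le.1 hx').1 (abs_le.1 hx').2) n
      _ ≤ ∫⁻ x, ENNReal.ofReal (y ^ (2 * n)) ∂μ := setLIntegral_le_lintegral _ _
      _ = _ := by simp
  have h2 : ∫⁻ x in {x : ℝ | y ≤ ‖x‖}, ENNReal.ofReal (x ^ (2 * n)) ∂μ ≤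
      ENNReal.ofReal (2 * (f a * a) * y ^ (2 * n)) := by
    rw [hf.eq_withDensity, restrict_withDensity
      (measurableSet_le measurable_const measurable_norm),
      lintegral_withDensity_eq_lintegral_mul _ hf.measurable.ennreal_ofReal hmeas]
    simp only [Pi.mul_apply, Real.norm_eq_abs]
    refine (setLIntegral_le_abs_le fun x => by rw [hsymm, Even.neg_pow ⟨n, by ring⟩]).trans ?_
    have h3 : ∫⁻ x in Ioi y, ENNReal.ofReal (f x) * ENNReal.ofReal (x ^ (2 * n)) ≤
        ENNReal.ofReal (f a * a * y ^ (2 * n)) := by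
      calc _ ≤ ∫⁻ x in Ioi y, ENNReal.ofReal (f a * a * y ^ (2 * n + 1)) *
            ENNReal.ofReal ((x ^ 2)⁻¹) := by
            refine setLIntegral_mono' measurableSet_Ioi fun x hx => ?_
            have hxy : y < x := hx
            have hx0 : 0 < x := hy0.trans hxy
            rw [← ENNReal.ofReal_mul (hf.nonneg x), ← ENNReal.ofReal_mul (by positivity)]
            refine ENNReal.ofReal_le_ofReal ?_
            have h4 := mul_pow_le_of_slope hy0 (fun x hx => ha.pos x (hay.trans hx))
              (fun x hx => ha.hasDerivAt x (hay.trans hx)) hy hxy.le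
            have h5 := mul_pow_le_of_slope (m := 1) (by linarith : 0 < a) ha.pos ha.hasDerivAt
              (by simpa using ha.one_le_slope) hay
            simp only [pow_one] at h5
            rw [← div_eq_mul_inv, le_div_iff₀ (by positivity)]
            calc f x * x ^ (2 * n) * x ^ 2 = f x * x ^ (2 * n + 2) := by ring
              _ ≤ f y * y ^ (2 * n + 2) := h4
              _ = f y * y * y ^ (2 * n + 1) := by ring
              _ ≤ f a * a * y ^ (2 * n + 1) := by gcongr
        _ = ENNReal.ofReal (f a * a * y ^ (2 * n)) := by
            rw [lintegral_const_mul' _ _ ENNReal.ofReal_ne_top, lintegral_Ioi_inv_sq hy0,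
              ← ENNReal.ofReal_mul (by positivity)]
            congr 1
            field_simp
            ring
    calc _ ≤ 2 * ENNReal.ofReal (f a * a * y ^ (2 * n)) := by gcongr
      _ = _ := by
        rw [show (2 : ℝ≥0∞) = ENNReal.ofReal 2 by simp, ← ENNReal.ofReal_mul (by norm_num)]
        congr 1
        ring
  refine (add_le_add h2 h1).trans (le_of_eq ?_)
  rw [← ENNReal.ofReal_add (by positivity) (by positivity)]
  congr 1
  ring

/-- If the Krein integral diverges, then Condition L implies Carleman's condition. -/
theorem ConditionL.carlemanCondition [IsProbabilityMeasure μ] (hL : ConditionL f)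
    (hf : IsDensity f μ) (hm : HasFiniteMoments μ)
    (hK : ∀ c : ℝ, 0 ≤ c → kreinIntegral f c = ⊤) : CarlemanCondition μ := by
  obtain ⟨a, ha, hlim⟩ := hL.exists_regularTail
  have hsymm := hL.1
  have ha1 := ha.one_le
  have hfa := ha.pos a le_rfl
  -- `2k + 4 = 2(k + 1) + 2` is the slope needed for the moment of order `2(k + 1)`.
  set A : ℕ → Set ℝ := fun k => {x | a ≤ x ∧ (2 * k + 4 : ℝ) ≤ logSlope f x} with hA
  have hne : ∀ k, (A k).Nonempty := fun k =>
    ((eventually_ge_atTop a).and (hlim.eventually_ge_atTop (2 * k + 4 : ℝ))).exists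
  have hbdd : ∀ k, BddBelow (A k) := fun k => ⟨a, fun x hx => hx.1⟩
  set s : ℕ → ℝ := fun k => sInf (A k) with hs
  have has : ∀ k, a ≤ s k := fun k => le_csInf (hne k) fun x hx => hx.1
  have hs0 : ∀ k, 0 < s k := fun k => by linarith [has k]
  have hdiv : ∑' k, ENNReal.ofReal (s k)⁻¹ = ⊤ := by
    by_contra hfin
    -- Layer-cake bound: `L_f(x)` is at most `4` plus twice the number of `k` with `s k ≤ x`.
    -- Integrated against `x⁻²`, each such `k` contributes at most `2 / s k`.
    have hpt : ∀ x ∈ Ioi a, ENNReal.ofReal ‖logSlope f x / x ^ 2‖ ≤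
        4 * ENNReal.ofReal ((x ^ 2)⁻¹) +
          ∑' k, 2 * (Ici (s k)).indicator (fun x => ENNReal.ofReal ((x ^ 2)⁻¹)) x := by
      intro x hx
      have hx' : a ≤ x := le_of_lt hx
      have hl := ha.one_le_slope x hx'
      rw [Real.norm_of_nonneg (div_nonneg (by linarith) (sq_nonneg x)), div_eq_mul_inv,
        ENNReal.ofReal_mul (by linarith)]
      set N := ⌊(logSlope f x - 2) / 2⌋₊ with hN
      have h1 : ∑ k ∈ Finset.range N,
          2 * (Ici (s k)).indicator (fun x => ENNReal.ofReal ((x ^ 2)⁻¹)) x =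
          (2 * N : ℝ≥0∞) * ENNReal.ofReal ((x ^ 2)⁻¹) := by
        rw [Finset.sum_congr rfl (g := fun _ => 2 * ENNReal.ofReal ((x ^ 2)⁻¹))]
        · simp; ring
        · intro k hk
          have hk : k + 1 ≤ N := Finset.mem_range.1 hk
          have h2 : ((k + 1 : ℕ) : ℝ) ≤ (logSlope f x - 2) / 2 :=
            (Nat.le_floor_iff' (by omega)).1 hk
          rw [indicator_of_mem]
          refine csInf_le (hbdd k) ⟨hx', ?_⟩
          push_cast at h2
          linarith
      refine le_trans ?_ (add_le_add_right (ENNReal.sum_le_tsum (Finset.range N)) _)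
      rw [h1, ← add_mul]
      gcongr
      have h3 : logSlope f x ≤ 4 + 2 * N := by
        have := Nat.lt_floor_add_one ((logSlope f x - 2) / 2)
        rw [← hN] at this
        linarith
      calc ENNReal.ofReal (logSlope f x) ≤ ENNReal.ofReal (4 + 2 * N) :=
            ENNReal.ofReal_le_ofReal h3
        _ = 4 + 2 * N := by
          rw [ENNReal.ofReal_add (by norm_num) (by positivity), ENNReal.ofReal_mul (by norm_num)]
          simp
    have hint : IntegrableOn (fun x => logSlope f x / x ^ 2) (Ioi a) := by
      have hmm : Measurable (logSlope f) := by
        have := measurable_deriv f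
        have := hf.measurable
        unfold logSlope
        fun_prop
      refine ⟨(hmm.div (by fun_prop)).aestronglyMeasurable, ?_⟩
      rw [hasFiniteIntegral_iff_norm]
      refine (setLIntegral_mono' measurableSet_Ioi hpt).trans_lt ?_
      rw [lintegral_add_left (by fun_prop), lintegral_const_mul' _ _ ENNReal.ofNat_ne_top,
        lintegral_Ioi_inv_sq (by linarith), lintegral_tsum fun k => ?_]
      · refine ENNReal.add_lt_top.2 ⟨ENNReal.mul_lt_top (by simp) ENNReal.ofReal_lt_top, ?_⟩
        refine lt_of_le_of_lt (b := ∑' k, 2 * ENNReal.ofReal (s k)⁻¹)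
          (ENNReal.tsum_le_tsum fun k => ?_) ?_
        · rw [lintegral_const_mul' _ _ ENNReal.ofNat_ne_top, lintegral_indicator measurableSet_Ici]
          gcongr
          rw [← lintegral_Ioi_inv_sq (hs0 k), ← setLIntegral_congr (Ioi_ae_eq_Ici (a := s k))]
          gcongr
          exact Measure.restrict_le_self
        · rw [ENNReal.tsum_mul_left]
          exact ENNReal.mul_lt_top (by simp) (lt_top_iff_ne_top.2 hfin)
      · exact (Measurable.const_mul (Measurable.indicator (by fun_prop) measurableSet_Ici)
          2).aemeasurable
    exact (kreinIntegral_lt_top_of_integrableOn hf hsymm ha (ha.integrableOn_neg_log hint)).ne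
      (hK a (by linarith))
  set C := 1 + 2 * (f a * a) with hC
  have hfa' : 0 < f a * a := mul_pos hfa (by linarith)
  have hC1 : 1 ≤ C := by linarith
  rw [CarlemanCondition, carlemanQuantity, eq_top_iff]
  have hterm : ∀ k : ℕ, ENNReal.ofReal (2 * C)⁻¹ * ENNReal.ofReal (s k)⁻¹ ≤
      ENNReal.ofReal (∫ x, x ^ (2 * (k + 1)) ∂μ) ^ (-(1 / (2 * ((k : ℝ) + 1)))) := by
    intro k
    -- `2 * s k` lies strictly above the infimum, which need not belong to `A k`.
    have h1 := ofReal_even_moment_le hf hm hsymm ha (n := k + 1) (y := 2 * s k)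
      (by linarith [has k, hs0 k]) (fun x hx => by
        obtain ⟨z, hz, hzx⟩ := (csInf_lt_iff (hbdd k) (hne k)).1
          (show s k < x by linarith [hs0 k])
        have := ha.monotoneOn (show z ∈ Ici a from hz.1)
          (show x ∈ Ici a from hz.1.trans hzx.le) hzx.le
        have := hz.2
        push_cast
        linarith)
    have hsk := hs0 k
    -- As `C ≥ 1`, the constant goes inside the power, and the root leaves a factor independent of
    -- `k`.
    have h2 : C * (2 * s k) ^ (2 * (k + 1)) ≤ (2 * C * s k) ^ (2 * (k + 1)) := by
      calc _ ≤ C ^ (2 * (k + 1)) * (2 * s k) ^ (2 * (k + 1)) := by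
            gcongr
            exact le_self_pow₀ hC1 (by omega)
        _ = _ := by rw [← mul_pow]; ring
    have h3 := h1.trans (ENNReal.ofReal_le_ofReal h2)
    have hpos : 0 < 2 * C * s k := by positivity
    calc _ = (ENNReal.ofReal ((2 * C * s k) ^ (2 * (k + 1)))) ^ (-(1 / (2 * ((k : ℝ) + 1)))) := by
          rw [ENNReal.ofReal_rpow_of_pos (by positivity), ← Real.rpow_natCast,
            ← Real.rpow_mul hpos.le, ← ENNReal.ofReal_mul (by positivity)]
          congr 1
          have : ((2 * (k + 1) : ℕ) : ℝ) * -(1 / (2 * ((k : ℝ) + 1))) = -1 := by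
            push_cast
            field_simp
          rw [this, Real.rpow_neg_one, mul_inv (2 * C)]
      _ ≤ _ := by
          rw [ENNReal.rpow_neg, ENNReal.rpow_neg]
          exact ENNReal.inv_le_inv.2 (ENNReal.rpow_le_rpow h3 (by positivity))
  refine le_trans ?_ (ENNReal.tsum_le_tsum hterm)
  rw [ENNReal.tsum_mul_left, hdiv, ENNReal.mul_top]
  simp only [ne_eq, ENNReal.ofReal_eq_zero, not_le]
  positivity

end Carleman

end MomentProblem

/-! ### Indeterminacy from a bound on evaluation at zero -/

namespace MomentProblem

variable {μ : Measure ℝ}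

theorem Lp_two_integrable [IsFiniteMeasure μ] (u : Lp ℝ 2 μ) : Integrable u μ :=
  (Lp.memLp u).integrable one_le_two

theorem integrable_abs_mul_bdd {u k : ℝ → ℝ} (hu : Integrable u μ) (hk : Measurable k) {B : ℝ}
    (hkB : ∀ x, |k x| ≤ B) : Integrable (fun x => |u x| * k x) μ :=
  hu.abs.mul_bdd (c := B) hk.aestronglyMeasurable (Eventually.of_forall hkB)

/-- If evaluation at `0` of polynomials is dominated by a weighted `L¹` norm, then it is
represented by a function dominated by the weight. -/
theorem exists_eval_zero_eq_integral [IsProbabilityMeasure μ] (hm : HasFiniteMoments μ)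
    {k : ℝ → ℝ} (hk : Measurable k) (hk0 : ∀ x, 0 ≤ k x) {B : ℝ} (hkB : ∀ x, k x ≤ B)
    (h : ∀ p : Polynomial ℝ, |p.eval 0| ≤ ∫ x, |p.eval x| * k x ∂μ) :
    ∃ v : ℝ → ℝ, MemLp v 2 μ ∧ (∀ᵐ x ∂μ, |v x| ≤ k x) ∧
      ∀ p : Polynomial ℝ, ∫ x, p.eval x * v x ∂μ = p.eval 0 := by
  have hkB' : ∀ x, |k x| ≤ B := fun x => by rw [abs_of_nonneg (hk0 x)]; exact hkB x
  have hB : 0 ≤ B := (hk0 0).trans (hkB 0)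
  set T := evalLp hm with hT
  set N : Lp ℝ 2 μ → ℝ := fun u => ∫ x, |u x| * k x ∂μ with hN
  have hNi : ∀ u : Lp ℝ 2 μ, Integrable (fun x => |u x| * k x) μ := fun u =>
    integrable_abs_mul_bdd (Lp_two_integrable u) hk hkB'
  have hNp : ∀ p, N (T p) = ∫ x, |p.eval x| * k x ∂μ := fun p =>
    integral_congr_ae (by filter_upwards [evalLp_ae hm p] with x hx; rw [hx])
  have hNB : ∀ u, N u ≤ B * ‖u‖ := by
    intro u
    have h1 := integral_abs_mul_le_sqrt_mul_sqrt (Lp.memLp u) (memLp_const (μ := μ) (1 : ℝ))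
    have h2 : ∫ x, u x ^ 2 ∂μ = ‖u‖ ^ 2 := by
      rw [← real_inner_self_eq_norm_sq, L2.inner_def]
      simp [sq]
    simp only [mul_one, one_pow, integral_const, probReal_univ, smul_eq_mul, Real.sqrt_one, h2,
      Real.sqrt_sq (norm_nonneg u)] at h1
    calc N u ≤ ∫ x, |u x| * B ∂μ :=
          integral_mono (hNi u) ((Lp_two_integrable u).abs.mul_const B)
            fun x => mul_le_mul_of_nonneg_left (hkB x) (abs_nonneg _)
      _ = (∫ x, |u x| ∂μ) * B := integral_mul_const _ _
      _ ≤ ‖u‖ * B := by gcongr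
      _ = _ := mul_comm _ _
  have hker : T.ker ≤ (Polynomial.leval (0 : ℝ)).ker := by
    intro p hp
    rw [LinearMap.mem_ker] at hp ⊢
    have h1 := h p
    rw [← hNp, hp] at h1
    have h2 := hNB 0
    rw [norm_zero, mul_zero] at h2
    exact abs_nonpos_iff.1 (h1.trans h2)
  -- `p ↦ p(0)` descends to classes in `L²(μ)`, because the domination makes it vanish when the
  -- class of `p` does.
  set F : Lp ℝ 2 μ →ₗ.[ℝ] ℝ :=
    ⟨T.range, (T.ker.liftQ (Polynomial.leval (0 : ℝ)) hker) ∘ₗ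
      (T.quotKerEquivRange.symm : T.range →ₗ[ℝ] _)⟩ with hF
  have hFp : ∀ p : Polynomial ℝ, F ⟨T p, LinearMap.mem_range_self T p⟩ = p.eval 0 := by
    intro p
    change (T.ker.liftQ (Polynomial.leval (0 : ℝ)) hker)
      (T.quotKerEquivRange.symm ⟨T p, LinearMap.mem_range_self T p⟩) = _
    rw [LinearMap.quotKerEquivRange_symm_apply_image]
    rfl
  have hcoe : ∀ (c : ℝ) (u : Lp ℝ 2 μ), N (c • u) = |c| * N u := by
    intro c u
    rw [hN]
    simp only
    rw [← integral_const_mul]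
    refine integral_congr_ae ?_
    filter_upwards [Lp.coeFn_smul c u] with x hx
    rw [hx, Pi.smul_apply, smul_eq_mul, abs_mul, mul_assoc]
  obtain ⟨ℓ, hℓF, hℓN⟩ := exists_extension_of_le_sublinear F N
    (fun c hc u => by rw [hcoe, abs_of_pos hc])
    (fun u w => by
      rw [hN]
      simp only
      rw [← integral_add (hNi u) (hNi w)]
      refine integral_mono_ae (hNi _) ((hNi u).add (hNi w)) ?_
      filter_upwards [Lp.coeFn_add u w] with x hx
      rw [hx, Pi.add_apply, ← add_mul]
      exact mul_le_mul_of_nonneg_right (abs_add_le _ _) (hk0 x))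
    (by
      rintro ⟨-, p, rfl⟩
      rw [hFp, hNp]
      exact (le_abs_self _).trans (h p))
  have hℓabs : ∀ u, |ℓ u| ≤ N u := by
    intro u
    refine abs_le.2 ⟨?_, hℓN u⟩
    have := hℓN ((-1 : ℝ) • u)
    rw [hcoe, map_smul] at this
    simp at this
    linarith
  set Λ : StrongDual ℝ (Lp ℝ 2 μ) := ℓ.mkContinuous B fun u => (hℓabs u).trans (hNB u) with hΛ
  set v : Lp ℝ 2 μ := (InnerProductSpace.toDual ℝ (Lp ℝ 2 μ)).symm Λ with hv
  have hinner : ∀ u : Lp ℝ 2 μ, inner ℝ v u = ℓ u := fun u =>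
    InnerProductSpace.toDual_symm_apply
  -- Domination by the seminorm `N`, tested on indicators, becomes the pointwise bound `|v| ≤ k`.
  have hset : ∀ s, MeasurableSet s → |∫ x in s, v x ∂μ| ≤ ∫ x in s, k x ∂μ := by
    intro s hs
    have h1 := hℓabs (indicatorConstLp 2 hs (measure_ne_top μ s) (1 : ℝ))
    rw [← hinner, real_inner_comm, L2.inner_indicatorConstLp_one] at h1
    refine h1.trans (le_of_eq ?_)
    rw [← integral_indicator hs]
    refine integral_congr_ae ?_
    filter_upwards [indicatorConstLp_coeFn (p := 2) (hs := hs) (hμs := measure_ne_top μ s)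
      (c := (1 : ℝ))] with x hx
    rw [hx]
    by_cases hxs : x ∈ s <;> simp [hxs]
  have hki : Integrable k μ := Integrable.of_bound hk.aestronglyMeasurable B
    (Eventually.of_forall hkB')
  have hle1 : (v : ℝ → ℝ) ≤ᵐ[μ] k := ae_le_of_forall_setIntegral_le (Lp_two_integrable v) hki
    fun s hs _ => (le_abs_self _).trans (hset s hs)
  have hle2 : (fun x => -v x) ≤ᵐ[μ] k :=
    ae_le_of_forall_setIntegral_le (Lp_two_integrable v).neg hki fun s hs _ => by
      rw [integral_neg]
      exact (neg_le_abs _).trans (hset s hs)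
  refine ⟨v, Lp.memLp v, ?_, fun p => ?_⟩
  · filter_upwards [hle1, hle2] with x h1 h2
    exact abs_le.2 ⟨by linarith, h1⟩
  · rw [← hFp p, ← hℓF, ← hinner, L2.inner_def]
    refine integral_congr_ae ?_
    filter_upwards [evalLp_ae hm p] with x hx
    rw [hx]
    simp

/-- Perturbing by a bounded function orthogonal to all monomials yields another solution of the
moment problem. -/
theorem mindet_of_orthogonal [IsProbabilityMeasure μ] (hm : HasFiniteMoments μ) {w : ℝ → ℝ}
    (hw : AEStronglyMeasurable w μ) (hw1 : ∀ᵐ x ∂μ, |w x| ≤ 1)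
    (horth : ∀ j : ℕ, ∫ x, x ^ j * w x ∂μ = 0) (hne : ¬ w =ᵐ[μ] 0) : MIndet μ := by
  have hmeas : AEMeasurable (fun x => ENNReal.ofReal (1 + w x)) μ :=
    (hw.aemeasurable.const_add 1).ennreal_ofReal
  have hfin : ∀ᵐ x ∂μ, ENNReal.ofReal (1 + w x) < ⊤ :=
    Eventually.of_forall fun _ => ENNReal.ofReal_lt_top
  have hreal : ∀ᵐ x ∂μ, (ENNReal.ofReal (1 + w x)).toReal = 1 + w x := by
    filter_upwards [hw1] with x hx
    exact ENNReal.toReal_ofReal (by linarith [(abs_le.1 hx).1])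
  have hxw : ∀ j : ℕ, Integrable (fun x => x ^ j * w x) μ := fun j =>
    (hm j).mul_bdd (c := 1) hw hw1
  have hcongr : ∀ j : ℕ, (fun x => (ENNReal.ofReal (1 + w x)).toReal • x ^ j) =ᵐ[μ]
      fun x => x ^ j + x ^ j * w x := by
    intro j
    filter_upwards [hreal] with x hx
    rw [hx, smul_eq_mul]
    ring
  have hmom : ∀ j : ℕ, ∫ x, x ^ j ∂(μ.withDensity fun x => ENNReal.ofReal (1 + w x)) =
      ∫ x, x ^ j ∂μ := by
    intro j
    rw [integral_withDensity_eq_integral_toReal_smul₀ hmeas hfin, integral_congr_ae (hcongr j),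
      integral_add (hm j) (hxw j), horth, add_zero]
  have hint : HasFiniteMoments (μ.withDensity fun x => ENNReal.ofReal (1 + w x)) := by
    intro j
    rw [integrable_withDensity_iff_integrable_smul₀' hmeas hfin]
    exact ((hm j).add (hxw j)).congr (hcongr j).symm
  have hw0 : Integrable w μ := by simpa using hxw 0
  have hI : ∫⁻ x, ENNReal.ofReal (1 + w x) ∂μ = 1 := by
    rw [← ofReal_integral_eq_lintegral_ofReal (f := fun x => 1 + w x)
      ((integrable_const 1).add hw0),
      integral_add (integrable_const 1) hw0]
    · have := horth 0
      simp only [pow_zero, one_mul] at this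
      simp [this]
    · filter_upwards [hw1] with x hx
      simp only [Pi.zero_apply]
      linarith [(abs_le.1 hx).1]
  refine ⟨hm, _, ⟨?_⟩, hint, hmom, ?_⟩
  · rw [withDensity_apply _ MeasurableSet.univ, setLIntegral_univ, hI]
  · intro heq
    have h1 : μ.withDensity (fun x => ENNReal.ofReal (1 + w x)) = μ.withDensity (fun _ => 1) := by
      rw [heq, withDensity_const, one_smul]
    rw [withDensity_eq_iff hmeas aemeasurable_const (by rw [hI]; simp)] at h1
    refine hne ?_
    filter_upwards [h1, hreal] with x hx hx'
    rw [hx] at hx'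
    simp at hx'
    simpa using hx'

/-- If `v` represents evaluation at `0`, then `x² v / C` is bounded by one because of the weight
`x⁻²`, kills `x^j` because `x^(j+2)` vanishes at `0`, and is nonzero because `∫ v = 1`. -/
theorem mindet_of_eval_zero_bound [IsProbabilityMeasure μ] (hm : HasFiniteMoments μ) {c C : ℝ}
    (hc : 1 ≤ c) (h : ∀ p : Polynomial ℝ, |p.eval 0| ≤
      C * ∫ x, |p.eval x| * {x : ℝ | c ≤ |x|}.indicator (fun x => (x ^ 2)⁻¹) x ∂μ) :
    MIndet μ := by
  set k : ℝ → ℝ := {x : ℝ | c ≤ |x|}.indicator (fun x => (x ^ 2)⁻¹) with hk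
  have hkm : Measurable k :=
    Measurable.indicator (by fun_prop) (measurableSet_le measurable_const measurable_norm)
  have hk0 : ∀ x, 0 ≤ k x := fun x => indicator_nonneg (fun x _ => by positivity) x
  have hkx : ∀ x, x ^ 2 * k x ≤ 1 := by
    intro x
    by_cases hx : x ∈ {x : ℝ | c ≤ |x|}
    · have : 0 < x ^ 2 := by
        rw [← sq_abs]
        have : c ≤ |x| := hx
        have : 0 < |x| := by linarith
        positivity
      rw [hk, indicator_of_mem hx, mul_inv_cancel₀ this.ne']
    · rw [hk, indicator_of_notMem hx, mul_zero]
      exact zero_le_one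
  have hk1 : ∀ x, k x ≤ 1 := by
    intro x
    by_cases hx : x ∈ {x : ℝ | c ≤ |x|}
    · rw [hk, indicator_of_mem hx, ← sq_abs]
      have h1 : c ≤ |x| := hx
      exact inv_le_one_of_one_le₀ (one_le_pow₀ (hc.trans h1))
    · rw [hk, indicator_of_notMem hx]
      exact zero_le_one
  have hC : 0 < C := by
    have h1 := h 1
    simp only [Polynomial.eval_one, abs_one, one_mul] at h1
    have h2 : 0 ≤ ∫ x, k x ∂μ := integral_nonneg hk0
    by_contra hC
    have := mul_nonpos_of_nonpos_of_nonneg (not_lt.1 hC) h2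
    linarith
  obtain ⟨v, hv, hvk, hvp⟩ := exists_eval_zero_eq_integral hm (k := fun x => C * k x)
    (hkm.const_mul C) (fun x => mul_nonneg hC.le (hk0 x)) (B := C)
    (fun x => mul_le_of_le_one_right hC.le (hk1 x)) (fun p => (h p).trans (le_of_eq (by
      rw [← integral_const_mul]
      congr 1
      funext x
      ring)))
  refine mindet_of_orthogonal hm (w := fun x => C⁻¹ * (x ^ 2 * v x)) ?_ ?_ ?_ ?_
  · exact ((Continuous.aestronglyMeasurable (by fun_prop)).mul hv.1).const_mul _
  · filter_upwards [hvk] with x hx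
    rw [abs_mul, abs_mul, abs_of_pos (inv_pos.2 hC), abs_of_nonneg (sq_nonneg x),
      inv_mul_le_iff₀ hC, mul_one]
    calc x ^ 2 * |v x| ≤ x ^ 2 * (C * k x) := by gcongr
      _ = C * (x ^ 2 * k x) := by ring
      _ ≤ C := mul_le_of_le_one_right hC.le (hkx x)
  · intro j
    have h1 := hvp (Polynomial.X ^ (j + 2))
    simp only [Polynomial.eval_pow, Polynomial.eval_X] at h1
    have h2 : ∀ x, x ^ j * (C⁻¹ * (x ^ 2 * v x)) = C⁻¹ * (x ^ (j + 2) * v x) := fun x => by ring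
    simp only [h2]
    rw [integral_const_mul, h1]
    simp
  · intro h0
    have hv0 : v =ᵐ[μ] 0 := by
      filter_upwards [h0, hvk] with x hx hx'
      -- Dividing by `x²` fails only at `0`, where `c ≥ 1` makes the weight, hence `v`, vanish.
      rcases eq_or_ne x 0 with rfl | hx0
      · have : k 0 = 0 := by
          rw [hk, indicator_of_notMem]
          rw [mem_ofPred_eq, abs_zero]
          linarith
        rw [this, mul_zero] at hx'
        exact abs_nonpos_iff.1 hx'
      · simpa [hC.ne', hx0] using hx
    have h1 := hvp 1
    have h2 : ∫ x, v x ∂μ = 0 := by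
      rw [integral_congr_ae hv0]; simp
    simp [h2] at h1

end MomentProblem

/-! ### The bound on evaluation at zero: Joukowski map, Mahler measure, Jensen -/

namespace MomentProblem

theorem ae_cos_ne_zero : ∀ᵐ θ : ℝ, Real.cos θ ≠ 0 := by
  have h : {θ : ℝ | Real.cos θ = 0} ⊆ range fun k : ℤ => (2 * (k : ℝ) + 1) * Real.pi / 2 := by
    intro θ hθ
    obtain ⟨k, hk⟩ := Real.cos_eq_zero_iff.1 hθ
    exact ⟨k, hk.symm⟩
  have h0 : volume {θ : ℝ | Real.cos θ = 0} = 0 := ((countable_range _).mono h).measure_zero _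
  rw [ae_iff]
  simpa using h0

/-- The homogenization `(1 + w²) ^ d * p (2 c w / (1 + w²))` of a real polynomial `p`. -/
noncomputable def joukowskiHomogenize (c : ℝ) (p : Polynomial ℝ) : Polynomial ℂ :=
  ∑ k ∈ Finset.range (p.natDegree + 1), Polynomial.C (p.coeff k : ℂ) *
    (Polynomial.C (2 * c : ℂ) * Polynomial.X) ^ k * (1 + Polynomial.X ^ 2) ^ (p.natDegree - k)

theorem joukowskiHomogenize_coeff_zero (c : ℝ) (p : Polynomial ℝ) :
    (joukowskiHomogenize c p).coeff 0 = (p.eval 0 : ℝ) := by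
  rw [Polynomial.coeff_zero_eq_eval_zero, joukowskiHomogenize, Polynomial.eval_finsetSum,
    Finset.sum_range_succ', Finset.sum_eq_zero]
  · simp [Polynomial.coeff_zero_eq_eval_zero]
  · intro k _
    simp

/-- Hence the map `2 c w / (1 + w²)`, which fixes `0`, takes the value `c / cos θ` at `w = e^(iθ)`:
the circle goes to the half-lines. -/
theorem norm_circleMap_and_one_add_sq (θ : ℝ) : ‖circleMap 0 1 θ‖ = 1 ∧
    1 + circleMap 0 1 θ ^ 2 = 2 * (Real.cos θ : ℂ) * circleMap 0 1 θ := by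
  constructor
  · simp
  · have h1 : circleMap 0 1 θ = Complex.exp (θ * Complex.I) := by simp [circleMap]
    have h2 : Complex.exp (-(θ * Complex.I)) * Complex.exp (θ * Complex.I) = 1 := by
      rw [← Complex.exp_add]; simp
    rw [h1, Complex.ofReal_cos, Complex.two_cos, add_mul, neg_mul, h2]
    ring

theorem norm_eval_one_add_X_sq (θ : ℝ) :
    ‖(1 + Polynomial.X ^ 2 : Polynomial ℂ).eval (circleMap 0 1 θ)‖ = 2 * |Real.cos θ| := by
  obtain ⟨h1, h2⟩ := norm_circleMap_and_one_add_sq θ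
  simp only [Polynomial.eval_add, Polynomial.eval_one, Polynomial.eval_pow, Polynomial.eval_X]
  rw [h2, norm_mul, h1, norm_mul, Complex.norm_real]
  simp

theorem norm_eval_joukowskiHomogenize (c : ℝ) (p : Polynomial ℝ) {θ : ℝ} (hθ : Real.cos θ ≠ 0) :
    ‖(joukowskiHomogenize c p).eval (circleMap 0 1 θ)‖ =
      (2 * |Real.cos θ|) ^ p.natDegree * |p.eval (c / Real.cos θ)| := by
  obtain ⟨h1, h2⟩ := norm_circleMap_and_one_add_sq θ
  have hcos : (Real.cos θ : ℂ) ≠ 0 := by exact_mod_cast hθ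
  set w := circleMap 0 1 θ with hw
  have key : (joukowskiHomogenize c p).eval w =
      (2 * (Real.cos θ : ℂ) * w) ^ p.natDegree * ((p.eval (c / Real.cos θ) : ℝ) : ℂ) := by
    rw [joukowskiHomogenize, Polynomial.eval_finsetSum, Polynomial.eval_eq_sum_range,
      Complex.ofReal_sum, Finset.mul_sum]
    refine Finset.sum_congr rfl fun k hk => ?_
    have hk' : k ≤ p.natDegree := by have := Finset.mem_range.1 hk; omega
    simp only [Polynomial.eval_mul, Polynomial.eval_pow, Polynomial.eval_C, Polynomial.eval_X,
      Polynomial.eval_add, Polynomial.eval_one]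
    rw [h2]
    obtain ⟨j, hj⟩ := Nat.exists_eq_add_of_le hk'
    rw [hj, Nat.add_sub_cancel_left]
    push_cast [-Complex.ofReal_cos]
    rw [div_pow, pow_add]
    have : (2 * (Real.cos θ : ℂ) * w) ^ k = (Real.cos θ : ℂ) ^ k * (2 * w) ^ k := by
      rw [← mul_pow]; ring
    rw [this, show (2 * (c : ℂ) * w) ^ k = (c : ℂ) ^ k * (2 * w) ^ k by rw [← mul_pow]; ring]
    field_simp
  rw [key, norm_mul, norm_pow, norm_mul, norm_mul, h1, Complex.norm_real, Complex.norm_real]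
  simp

/-- The roots `±i` lie on the unit circle, so clearing denominators does not change the mean of the
logarithm. -/
theorem mahlerMeasure_one_add_X_sq : (1 + Polynomial.X ^ 2 : Polynomial ℂ).mahlerMeasure = 1 := by
  have : (1 + Polynomial.X ^ 2 : Polynomial ℂ) =
      (Polynomial.X - Polynomial.C Complex.I) * (Polynomial.X + Polynomial.C Complex.I) := by
    have h : (Polynomial.C Complex.I : Polynomial ℂ) * Polynomial.C Complex.I = -1 := by
      rw [← Polynomial.C_mul, Complex.I_mul_I]; simp
    linear_combination h
  rw [this, Polynomial.mahlerMeasure_mul, Polynomial.mahlerMeasure_X_sub_C,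
    Polynomial.mahlerMeasure_X_add_C]
  simp

/-- Subharmonicity of `log |p|` on the complement of the two half-lines `|x| ≥ c`. -/
theorem log_abs_eval_zero_le {c : ℝ} {p : Polynomial ℝ} (hp : p.eval 0 ≠ 0) :
    IntervalIntegrable (fun θ => Real.log |p.eval (c / Real.cos θ)|) volume 0 Real.pi ∧
      Real.log |p.eval 0| ≤
        Real.pi⁻¹ * ∫ θ in 0..Real.pi, Real.log |p.eval (c / Real.cos θ)| := by
  set P := joukowskiHomogenize c p with hP
  set Q : Polynomial ℂ := 1 + Polynomial.X ^ 2 with hQ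
  set F : ℝ → ℝ := fun θ => Real.log |p.eval (c / Real.cos θ)| with hF
  have hPi := P.intervalIntegrable_mahlerMeasure
  have hQi := Q.intervalIntegrable_mahlerMeasure
  have hroots : ∀ᵐ θ : ℝ, θ ∈ uIoc 0 (2 * Real.pi) →
      Real.log ‖P.eval (circleMap 0 1 θ)‖ - p.natDegree * Real.log ‖Q.eval (circleMap 0 1 θ)‖ =
        F θ := by
    have hP0 : P ≠ 0 := by
      intro h0
      have := joukowskiHomogenize_coeff_zero c p
      rw [← hP, h0] at this
      simp only [Polynomial.coeff_zero] at this
      exact hp (by exact_mod_cast this.symm)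
    have hfin : ({θ | P.eval (circleMap 0 1 θ) = 0} ∩ Ioc 0 (2 * Real.pi)).Finite := by
      refine Set.Finite.of_finite_image
        ((Polynomial.finite_setOfPred_isRoot hP0).subset (t := (circleMap 0 1) '' _) ?_) ?_
      · rintro _ ⟨θ, hθ, rfl⟩
        exact hθ.1
      · have h := injOn_circleMap_of_abs_sub_le (c := 0) (R := 1) (a := 0) (b := 2 * Real.pi)
          one_ne_zero (by rw [zero_sub, abs_neg, abs_of_pos Real.two_pi_pos])
        rw [uIoc_of_le Real.two_pi_pos.le] at h
        exact h.mono inter_subset_right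
    have hae : ∀ᵐ θ : ℝ, θ ∉ ({θ | P.eval (circleMap 0 1 θ) = 0} ∩ Ioc 0 (2 * Real.pi)) :=
      measure_eq_zero_iff_ae_notMem.1 (hfin.measure_zero _)
    filter_upwards [ae_cos_ne_zero, hae] with θ hθ hθ' hmem
    rw [uIoc_of_le Real.two_pi_pos.le] at hmem
    have hne : P.eval (circleMap 0 1 θ) ≠ 0 := fun h => hθ' ⟨h, hmem⟩
    have h1 := norm_eval_joukowskiHomogenize c p hθ
    have h2 := norm_eval_one_add_X_sq θ
    have h3 : 0 < 2 * |Real.cos θ| := by positivity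
    have h4 : |p.eval (c / Real.cos θ)| ≠ 0 := by
      intro h0
      rw [h0, mul_zero, norm_eq_zero] at h1
      exact hne h1
    rw [h1, h2, Real.log_mul (pow_pos h3 _).ne' h4, Real.log_pow]
    ring
  have hFi : IntervalIntegrable F volume 0 (2 * Real.pi) :=
    (hPi.sub (hQi.const_mul _)).congr_ae ((ae_restrict_iff' measurableSet_uIoc).2 hroots)
  have hQ0 : ∫ θ in 0..2 * Real.pi, Real.log ‖Q.eval (circleMap 0 1 θ)‖ = 0 := by
    have h1 : Q.logMahlerMeasure = 0 := by
      rw [Polynomial.logMahlerMeasure_eq_log_MahlerMeasure, mahlerMeasure_one_add_X_sq, Real.log_one]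
    rw [Polynomial.logMahlerMeasure, Real.circleAverage, smul_eq_mul] at h1
    exact (mul_eq_zero.1 h1).resolve_left (inv_ne_zero Real.two_pi_pos.ne')
  have hint : ∫ θ in 0..2 * Real.pi, F θ =
      ∫ θ in 0..2 * Real.pi, Real.log ‖P.eval (circleMap 0 1 θ)‖ := by
    rw [← intervalIntegral.integral_congr_ae hroots, intervalIntegral.integral_sub hPi
      (hQi.const_mul _), intervalIntegral.integral_const_mul, hQ0]
    ring
  have hle : Real.log |p.eval 0| ≤ (2 * Real.pi)⁻¹ * ∫ θ in 0..2 * Real.pi, F θ := by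
    -- At index `0` this is the mean-value inequality `|P(0)| ≤ M(P)`.
    have h1 := Polynomial.norm_coeff_le_choose_mul_mahlerMeasure 0 P
    rw [joukowskiHomogenize_coeff_zero, Complex.norm_real, Nat.choose_zero_right, Nat.cast_one,
      one_mul, Real.norm_eq_abs] at h1
    have h2 := Real.log_le_log (abs_pos.2 hp) h1
    rw [← Polynomial.logMahlerMeasure_eq_log_MahlerMeasure, Polynomial.logMahlerMeasure,
      Real.circleAverage, smul_eq_mul, ← hint] at h2
    exact h2
  have hsub1 : IntervalIntegrable F volume 0 Real.pi :=
    hFi.mono_set (by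
      rw [uIcc_of_le Real.pi_pos.le, uIcc_of_le Real.two_pi_pos.le]
      exact Icc_subset_Icc_right (by linarith [Real.pi_pos]))
  have hsub2 : IntervalIntegrable F volume Real.pi (2 * Real.pi) :=
    hFi.mono_set (by
      rw [uIcc_of_le (by linarith [Real.pi_pos]), uIcc_of_le Real.two_pi_pos.le]
      exact Icc_subset_Icc_left Real.pi_pos.le)
  have hsymm : ∫ θ in Real.pi..2 * Real.pi, F θ = ∫ θ in 0..Real.pi, F θ := by
    have h := intervalIntegral.integral_comp_sub_left (a := 0) (b := Real.pi) F (2 * Real.pi)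
    rw [sub_zero, show 2 * Real.pi - Real.pi = Real.pi by ring] at h
    rw [← h]
    simp only [hF, Real.cos_two_pi_sub]
  refine ⟨hsub1, ?_⟩
  rw [← intervalIntegral.integral_add_adjacent_intervals hsub1 hsub2, hsymm] at hle
  refine hle.trans (le_of_eq ?_)
  have := Real.pi_pos.ne'
  field_simp
  ring

section

variable {f : ℝ → ℝ} {μ : Measure ℝ} {c : ℝ}

/-- After `θ ↦ π/2 - θ`, Jordan's inequality gives `c / sin s ≤ K / s` with `K = cπ/2`. As `-log f`
increases, it is dominated by `-log f(K / s)`, integrable by the substitution `x = K / s`. -/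
theorem RegularTail.intervalIntegrable_log_comp (hc : RegularTail f c) (hf : Measurable f)
    (hsymm : ∀ x, f (-x) = f x)
    (hi : IntegrableOn (fun x => -Real.log (f x) / x ^ 2) (Ioi c)) :
    IntervalIntegrable (fun θ => Real.log (f (c / Real.cos θ))) volume 0 Real.pi := by
  have hc1 := hc.one_le
  have hc0 : 0 < c := by linarith
  have hpi := Real.pi_pos
  set K := c * Real.pi / 2 with hK
  have hK0 : 0 < K := by positivity
  have himage : (fun x => K / x) '' Ioi c = Ioo 0 (Real.pi / 2) := by
    ext s
    constructor
    · rintro ⟨x, hx, rfl⟩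
      have hx0 : 0 < x := hc0.trans hx
      refine ⟨by positivity, ?_⟩
      simp only
      rw [div_lt_iff₀ hx0, hK]
      have : c < x := hx
      nlinarith
    · rintro ⟨h1, h2⟩
      refine ⟨K / s, ?_, by field_simp⟩
      simp only [mem_Ioi]
      rw [lt_div_iff₀ h1, hK]
      nlinarith
  have hu : IntegrableOn (fun s => -Real.log (f (K / s))) (Ioo 0 (Real.pi / 2)) := by
    rw [← himage, integrableOn_image_iff_integrableOn_abs_deriv_smul measurableSet_Ioi
      (f' := fun x => -(K / x ^ 2))]
    · refine IntegrableOn.congr_fun (f := fun x => K * (-Real.log (f x) / x ^ 2)) (μ := volume)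
        (Integrable.const_mul hi K) (fun x hx => ?_) measurableSet_Ioi
      have hx0 : 0 < x := hc0.trans hx
      simp only [smul_eq_mul]
      rw [abs_neg, abs_of_pos (by positivity), div_div_cancel₀ hK0.ne']
      ring
    · intro x hx
      have hx0 : 0 < x := hc0.trans hx
      have := ((hasDerivAt_inv hx0.ne').const_mul K).hasDerivWithinAt (s := Ioi c)
      simp only [div_eq_mul_inv]
      refine this.congr_deriv ?_
      ring
    · intro x hx y hy hxy
      have hx0 : 0 < x := hc0.trans hx
      have hy0 : 0 < y := hc0.trans hy
      simp only at hxy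
      rw [div_eq_div_iff hx0.ne' hy0.ne'] at hxy
      exact (mul_left_cancel₀ hK0.ne' hxy).symm
  have hsin : IntervalIntegrable (fun s => Real.log (f (c / Real.sin s))) volume
      0 (Real.pi / 2) := by
    rw [intervalIntegrable_iff_integrableOn_Ioo_of_le (by positivity)]
    refine hu.mono' ?_ ?_
    · exact (hf.comp (measurable_const.div Real.measurable_sin)).log.aestronglyMeasurable
    · refine (ae_restrict_iff' measurableSet_Ioo).2 (Eventually.of_forall fun s hs => ?_)
      have hs1 : 0 < Real.sin s := Real.sin_pos_of_pos_of_lt_pi hs.1 (by linarith [hs.2])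
      have h1 : c ≤ c / Real.sin s := by
        rw [le_div_iff₀ hs1]
        exact mul_le_of_le_one_right hc0.le (Real.sin_le_one s)
      have h2 : c / Real.sin s ≤ K / s := by
        have h3 := Real.mul_le_sin hs.1.le hs.2.le
        rw [div_le_div_iff₀ hs1 hs.1, hK]
        have h4 : s ≤ Real.pi / 2 * Real.sin s := by
          calc s = Real.pi / 2 * (2 / Real.pi * s) := by field_simp
            _ ≤ _ := by gcongr
        nlinarith
      have h5 := hc.monotoneOn_neg_log (show c / Real.sin s ∈ Ici c from h1)
        (show K / s ∈ Ici c from h1.trans h2) h2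
      rw [← norm_neg, Real.norm_of_nonneg (hc.neg_log_nonneg h1)]
      exact h5
  have h1 : IntervalIntegrable (fun θ => Real.log (f (c / Real.cos θ))) volume
      0 (Real.pi / 2) := by
    have := (hsin.comp_sub_left (Real.pi / 2)).symm
    simpa only [Real.sin_pi_div_two_sub, sub_self, sub_zero] using this
  have h2 : IntervalIntegrable (fun θ => Real.log (f (c / Real.cos θ))) volume
      (Real.pi / 2) Real.pi := by
    have := (h1.comp_sub_left Real.pi).symm
    simp only [Real.cos_pi_sub, div_neg, hsymm, sub_zero] at this
    rwa [show Real.pi - Real.pi / 2 = Real.pi / 2 by ring] at this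
  exact h1.trans h2

/-- Substituting `x = c / cos θ` gives `sin θ dθ = c x⁻² dx`, the source of the weight `x⁻²`. An
inequality avoids identifying the image. -/
theorem lintegral_abs_eval_cos_le (hc : 0 < c) (p : Polynomial ℝ) :
    ∫⁻ θ in Ioo 0 Real.pi, ENNReal.ofReal
        (|p.eval (c / Real.cos θ)| * (f (c / Real.cos θ) * Real.sin θ)) ≤
      ENNReal.ofReal c * ∫⁻ x in {x : ℝ | c ≤ |x|}, ENNReal.ofReal (|p.eval x| * f x * (x ^ 2)⁻¹) := by
  set T : Set ℝ := Ioo 0 Real.pi ∩ {θ | Real.cos θ ≠ 0} with hT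
  have hTm : MeasurableSet T :=
    measurableSet_Ioo.inter (Real.measurable_cos (measurableSet_singleton 0).compl)
  have hTae : (Ioo 0 Real.pi : Set ℝ) =ᵐ[volume] T := by
    filter_upwards [ae_cos_ne_zero] with θ hθ
    refine propext ⟨fun h => ⟨h, hθ⟩, fun h => h.1⟩
  have hder : ∀ θ ∈ T, HasDerivWithinAt (fun θ => c / Real.cos θ)
      (c * Real.sin θ / Real.cos θ ^ 2) T θ := by
    intro θ hθ
    have := (((Real.hasDerivAt_cos θ).inv hθ.2).const_mul c).hasDerivWithinAt (s := T)
    simp only [div_eq_mul_inv c]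
    refine this.congr_deriv ?_
    ring
  have hinj : InjOn (fun θ => c / Real.cos θ) T := by
    intro x hx y hy hxy
    simp only at hxy
    rw [div_eq_div_iff hx.2 hy.2] at hxy
    exact Real.injOn_cos ⟨hx.1.1.le, hx.1.2.le⟩ ⟨hy.1.1.le, hy.1.2.le⟩
      (mul_left_cancel₀ hc.ne' hxy).symm
  have hcv := lintegral_image_eq_lintegral_abs_deriv_mul hTm hder hinj
    (fun x => ENNReal.ofReal (|p.eval x| * f x * (x ^ 2)⁻¹))
  have hsub : (fun θ => c / Real.cos θ) '' T ⊆ {x : ℝ | c ≤ |x|} := by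
    rintro _ ⟨θ, hθ, rfl⟩
    simp only [mem_ofPred_eq]
    rw [abs_div, abs_of_pos hc, le_div_iff₀ (abs_pos.2 hθ.2)]
    exact mul_le_of_le_one_right hc.le (Real.abs_cos_le_one θ)
  refine le_trans (le_of_eq ?_) (mul_le_mul_right (lintegral_mono_set hsub) _)
  rw [hcv, setLIntegral_congr hTae, ← lintegral_const_mul' _ _ ENNReal.ofReal_ne_top]
  refine setLIntegral_congr_fun hTm fun θ hθ => ?_
  have hs : 0 < Real.sin θ := Real.sin_pos_of_pos_of_lt_pi hθ.1.1 hθ.1.2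
  have hcos : Real.cos θ ≠ 0 := hθ.2
  rw [← ENNReal.ofReal_mul (abs_nonneg _), ← ENNReal.ofReal_mul hc.le]
  congr 1
  rw [abs_of_nonneg (show 0 ≤ c * Real.sin θ / Real.cos θ ^ 2 by positivity)]
  field_simp

/-- Adding `log (f · sin)` to `log |p|` before Jensen's inequality for `exp` turns the mean of
logarithms into an integral against `μ`. The price is the constant factor `exp` of minus the mean of
the added term, integrable by hypothesis. -/
theorem RegularTail.abs_eval_zero_le [IsProbabilityMeasure μ] (hc : RegularTail f c)
    (hf : IsDensity f μ) (hm : HasFiniteMoments μ) (hsymm : ∀ x, f (-x) = f x)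
    (hi : IntegrableOn (fun x => -Real.log (f x) / x ^ 2) (Ioi c)) :
    ∃ C : ℝ, ∀ p : Polynomial ℝ, |p.eval 0| ≤
      C * ∫ x, |p.eval x| * {x : ℝ | c ≤ |x|}.indicator (fun x => (x ^ 2)⁻¹) x ∂μ := by
  have hc1 := hc.one_le
  have hc0 : 0 < c := by linarith
  have hpi := Real.pi_pos
  set k : ℝ → ℝ := {x : ℝ | c ≤ |x|}.indicator (fun x => (x ^ 2)⁻¹) with hk
  have hS : MeasurableSet {x : ℝ | c ≤ |x|} := measurableSet_le measurable_const measurable_norm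
  have hkm : Measurable k := Measurable.indicator (by fun_prop) hS
  have hk0 : ∀ x, 0 ≤ k x := fun x => indicator_nonneg (fun x _ => by positivity) x
  have hk1 : ∀ x, |k x| ≤ 1 := by
    intro x
    rw [abs_of_nonneg (hk0 x)]
    by_cases hx : x ∈ {x : ℝ | c ≤ |x|}
    · rw [hk, indicator_of_mem hx, ← sq_abs]
      have h1 : c ≤ |x| := hx
      exact inv_le_one_of_one_le₀ (one_le_pow₀ (hc1.trans h1))
    · rw [hk, indicator_of_notMem hx]
      exact zero_le_one
  set lW : ℝ → ℝ := fun θ => Real.log (f (c / Real.cos θ)) + Real.log (Real.sin θ) with hlW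
  have hlWi : IntervalIntegrable lW volume 0 Real.pi :=
    (hc.intervalIntegrable_log_comp hf.measurable hsymm hi).add intervalIntegrable_log_sin
  refine ⟨c * Real.pi⁻¹ * Real.exp (-(Real.pi⁻¹ * ∫ θ in 0..Real.pi, lW θ)), fun p => ?_⟩
  have hI0 : 0 ≤ ∫ x, |p.eval x| * k x ∂μ :=
    integral_nonneg fun x => mul_nonneg (abs_nonneg _) (hk0 x)
  by_cases hp : p.eval 0 = 0
  · rw [hp, abs_zero]
    positivity
  obtain ⟨hFi, hle⟩ := log_abs_eval_zero_le (c := c) hp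
  have hp0 : p ≠ 0 := by rintro rfl; simp at hp
  -- comparison of the two weighted `L¹` norms
  have hki := integrable_abs_mul_bdd (hm.integrable_eval p) hkm hk1
  have hlin : ∫⁻ x in {x : ℝ | c ≤ |x|}, ENNReal.ofReal (|p.eval x| * f x * (x ^ 2)⁻¹) =
      ENNReal.ofReal (∫ x, |p.eval x| * k x ∂μ) := by
    rw [ofReal_integral_eq_lintegral_ofReal hki
      (Eventually.of_forall fun x => mul_nonneg (abs_nonneg _) (hk0 x)), hf.eq_withDensity,
      lintegral_withDensity_eq_lintegral_mul _ hf.measurable.ennreal_ofReal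
        (show Measurable fun x => ENNReal.ofReal (|p.eval x| * k x) from
          (p.continuous.measurable.norm.mul hkm).ennreal_ofReal), ← lintegral_indicator hS]
    congr 1
    funext x
    rw [Pi.mul_apply, ← ENNReal.ofReal_mul (hf.nonneg x)]
    by_cases hx : x ∈ {x : ℝ | c ≤ |x|}
    · rw [hk, indicator_of_mem hx, indicator_of_mem hx]
      congr 1
      ring
    · rw [hk, indicator_of_notMem hx, indicator_of_notMem hx]
      simp
  set G : ℝ → ℝ := fun θ => |p.eval (c / Real.cos θ)| * (f (c / Real.cos θ) * Real.sin θ) with hG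
  have hG0 : ∀ θ ∈ Ioo 0 Real.pi, 0 ≤ G θ := fun θ hθ =>
    mul_nonneg (abs_nonneg _) (mul_nonneg (hf.nonneg _)
      (Real.sin_pos_of_pos_of_lt_pi hθ.1 hθ.2).le)
  have hGle := lintegral_abs_eval_cos_le (f := f) hc0 p
  rw [hlin, ← ENNReal.ofReal_mul hc0.le] at hGle
  have hcm : Measurable fun θ => c / Real.cos θ := measurable_const.div Real.measurable_cos
  have hGm : Measurable G := (p.continuous.measurable.comp hcm).norm.mul
    ((hf.measurable.comp hcm).mul Real.measurable_sin)
  have hG0ae : 0 ≤ᵐ[volume.restrict (Ioo 0 Real.pi)] G :=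
    (ae_restrict_iff' measurableSet_Ioo).2 (Eventually.of_forall hG0)
  have hGi : IntegrableOn G (Ioo 0 Real.pi) := by
    refine ⟨hGm.aestronglyMeasurable, ?_⟩
    rw [hasFiniteIntegral_iff_ofReal hG0ae]
    exact hGle.trans_lt ENNReal.ofReal_lt_top
  have hGint : ∫ θ in Ioo 0 Real.pi, G θ ≤ c * ∫ x, |p.eval x| * k x ∂μ := by
    rw [integral_eq_lintegral_of_nonneg_ae hG0ae hGm.aestronglyMeasurable]
    exact ENNReal.toReal_le_of_le_ofReal (by positivity) hGle
  -- Jensen's inequality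
  have hroot : ∀ᵐ θ : ℝ, θ ∈ Ioo 0 Real.pi → Real.exp (Real.log |p.eval (c / Real.cos θ)| + lW θ) =
      G θ := by
    have hfin : {θ : ℝ | (θ ∈ Ioo 0 Real.pi ∧ Real.cos θ ≠ 0) ∧
        p.eval (c / Real.cos θ) = 0}.Finite := by
      refine Set.Finite.of_finite_image ((Polynomial.finite_setOfPred_isRoot hp0).subset
        (t := (fun θ => c / Real.cos θ) '' _) ?_) ?_
      · rintro _ ⟨θ, hθ, rfl⟩
        exact hθ.2
      · intro x hx y hy hxy
        simp only at hxy
        rw [div_eq_div_iff hx.1.2 hy.1.2] at hxy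
        exact Real.injOn_cos ⟨hx.1.1.1.le, hx.1.1.2.le⟩ ⟨hy.1.1.1.le, hy.1.1.2.le⟩
          (mul_left_cancel₀ hc0.ne' hxy).symm
    filter_upwards [ae_cos_ne_zero, measure_eq_zero_iff_ae_notMem.1 (hfin.measure_zero _)]
      with θ hθ hθ' hmem
    have h1 : p.eval (c / Real.cos θ) ≠ 0 := fun h => hθ' ⟨⟨hmem, hθ⟩, h⟩
    have h2 : 0 < Real.sin θ := Real.sin_pos_of_pos_of_lt_pi hmem.1 hmem.2
    have h3 : 0 < f (c / Real.cos θ) := by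
      have h4 : c ≤ |c / Real.cos θ| := by
        rw [abs_div, abs_of_pos hc0, le_div_iff₀ (abs_pos.2 hθ)]
        exact mul_le_of_le_one_right hc0.le (Real.abs_cos_le_one θ)
      rcases abs_choice (c / Real.cos θ) with h5 | h5
      · rw [h5] at h4
        exact hc.pos _ h4
      · rw [h5] at h4
        rw [← hsymm]
        exact hc.pos _ h4
    rw [hlW, Real.exp_add, Real.exp_add, Real.exp_log (abs_pos.2 h1), Real.exp_log h2,
      Real.exp_log h3]
  have hroot' := (ae_restrict_iff' measurableSet_Ioo).2 hroot
  set m : Measure ℝ := volume.restrict (Ioo 0 Real.pi) with hm'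
  have hmu : m.real univ = Real.pi := by
    simp [hm', Measure.real, Real.pi_pos.le]
  have : IsFiniteMeasure m := ⟨by simp [hm']⟩
  have : NeZero m := ⟨by
    intro h0
    rw [h0] at hmu
    simp at hmu
    exact hpi.ne hmu⟩
  have hsumi : Integrable (fun θ => Real.log |p.eval (c / Real.cos θ)| + lW θ) m := by
    have := hFi.add hlWi
    rwa [intervalIntegrable_iff_integrableOn_Ioo_of_le hpi.le] at this
  have hJ := (convexOn_exp).map_average_le (μ := m) Real.continuous_exp.continuousOn isClosed_univ
    (f := fun θ => Real.log |p.eval (c / Real.cos θ)| + lW θ)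
    (Eventually.of_forall fun _ => mem_univ _) hsumi
    (hGi.congr (hroot'.mono fun θ h => h.symm))
  rw [average_eq, average_eq, hmu, integral_congr_ae hroot', smul_eq_mul, smul_eq_mul] at hJ
  have hsplit : ∫ θ, (Real.log |p.eval (c / Real.cos θ)| + lW θ) ∂m =
      (∫ θ in 0..Real.pi, Real.log |p.eval (c / Real.cos θ)|) + ∫ θ in 0..Real.pi, lW θ := by
    rw [← intervalIntegral.integral_add hFi hlWi, intervalIntegral.integral_of_le hpi.le,
      integral_Ioc_eq_integral_Ioo]
  rw [hsplit, mul_add, Real.exp_add] at hJ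
  have h1 : |p.eval 0| ≤ Real.exp (Real.pi⁻¹ *
      ∫ θ in 0..Real.pi, Real.log |p.eval (c / Real.cos θ)|) := by
    rw [← Real.log_le_iff_le_exp (abs_pos.2 hp)]
    exact hle
  set b := Real.pi⁻¹ * ∫ θ in 0..Real.pi, lW θ with hb
  set a := Real.exp (Real.pi⁻¹ * ∫ θ in 0..Real.pi, Real.log |p.eval (c / Real.cos θ)|) with ha
  calc |p.eval 0| ≤ a := h1
    _ = a * Real.exp b * Real.exp (-b) := by
      rw [mul_assoc, ← Real.exp_add]; simp
    _ ≤ (Real.pi⁻¹ * (c * ∫ x, |p.eval x| * k x ∂μ)) * Real.exp (-b) := by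
      refine mul_le_mul_of_nonneg_right (hJ.trans ?_) (Real.exp_pos _).le
      exact mul_le_mul_of_nonneg_left hGint (inv_pos.2 hpi).le
    _ = _ := by ring

end

end MomentProblem

/-! ### Krein's theorem and the final equivalence -/

namespace MomentProblem

variable {f : ℝ → ℝ} {μ : Measure ℝ}

/-- **Krein's theorem** under Condition L. -/
theorem ConditionL.mindet [IsProbabilityMeasure μ] (hL : ConditionL f) (hf : IsDensity f μ)
    (hm : HasFiniteMoments μ) (hK : KreinCondition f) : MIndet μ := by
  obtain ⟨a, ha, -⟩ := hL.exists_regularTail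
  obtain ⟨c, -, hc⟩ := hK
  -- The cut-off is enlarged so that the tail is regular and lies inside the domain of the finite
  -- Krein integral.
  have hb := ha.mono (le_max_left a c)
  obtain ⟨C, hC⟩ := hb.abs_eval_zero_le hf hm hL.1
    (integrableOn_of_kreinIntegral_lt_top hf hb (le_max_right a c) hc)
  exact mindet_of_eval_zero_bound hm hb.one_le hC

theorem IsDensity.map_neg_eq_self (hf : IsDensity f μ) (hsymm : ∀ x, f (-x) = f x) :
    μ.map (fun x => -x) = μ := by
  ext s hs
  rw [Measure.map_apply measurable_neg hs, hf.eq_withDensity,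
    withDensity_apply _ (measurable_neg hs), withDensity_apply _ hs]
  rw [← (Measure.measurePreserving_neg (volume : Measure ℝ)).setLIntegral_comp_preimage_emb
      (MeasurableEquiv.neg ℝ).measurableEmbedding _ s]
  simp only [hsymm]

theorem IsDensity.measure_compl_zero_ne_zero [IsProbabilityMeasure μ] (hf : IsDensity f μ) :
    μ {0}ᶜ ≠ 0 := by
  have h : μ {0} = 0 := by
    rw [hf.eq_withDensity]
    exact withDensity_absolutelyContinuous _ _ (measure_singleton 0)
  rw [prob_compl_eq_one_sub (measurableSet_singleton 0), h]
  simp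

theorem MDet.mdetStieltjes (h : MDet μ) (h0 : μ (Iio 0) = 0) : MDetStieltjes μ :=
  ⟨h0, h.1, fun ν hν _ hm hs => h.2 ν hν hm hs⟩

theorem MDet.not_mindet (h : MDet μ) : ¬ MIndet μ :=
  fun ⟨_, ν, hν, hm, hs, hne⟩ => hne (h.2 ν hν hm hs)

end MomentProblem

theorem theorem9 {Ω : Type*} [MeasurableSpace Ω] (P : Measure Ω) [IsProbabilityMeasure P]
    (X : Ω → ℝ) (hX : AEMeasurable X P)
    (hmom : MomentProblem.HasFiniteMoments (P.map X))
    (f : ℝ → ℝ) (hf : MomentProblem.IsDensity f (P.map X))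
    (hL : MomentProblem.ConditionL f) :
    ((∀ c : ℝ, 0 ≤ c → MomentProblem.kreinIntegral f c = ⊤) →
      MomentProblem.CarlemanCondition (P.map X) ∧
      MomentProblem.MDet (P.map X) ∧
      MomentProblem.MDet (P.map (fun ω => X ω ^ 2)) ∧
      MomentProblem.MDetStieltjes (P.map (fun ω => X ω ^ 2))) ∧
    (MomentProblem.MIndet (P.map X) ↔ MomentProblem.KreinCondition f) := by
  have : IsProbabilityMeasure (P.map X) := Measure.isProbabilityMeasure_map hX
  have h0 := hf.measure_compl_zero_ne_zero
  have hsq : P.map (fun ω => X ω ^ 2) = (P.map X).map (fun x => x ^ 2) :=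
    (AEMeasurable.map_map_of_aemeasurable (g := fun x : ℝ => x ^ 2) (by fun_prop) hX).symm
  have hneg : (P.map X).map (fun x => x ^ 2) (Iio 0) = 0 := by
    rw [Measure.map_apply (by fun_prop) measurableSet_Iio]
    convert measure_empty (μ := P.map X)
    ext x
    simp [sq_nonneg]
  refine ⟨fun hK => ?_, fun hI => ?_, hL.mindet hf hmom⟩
  · have hC := hL.carlemanCondition hf hmom hK
    have hdet := hC.mdet_map_sq hmom h0 (hf.map_neg_eq_self hL.1)
    rw [hsq]
    exact ⟨hC, hC.mdet hmom h0, hdet, hdet.mdetStieltjes hneg⟩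
  · by_contra hK
    have hK' : ∀ c : ℝ, 0 ≤ c → MomentProblem.kreinIntegral f c = ⊤ := by
      intro c hc
      by_contra h
      exact hK ⟨c, hc, lt_top_iff_ne_top.2 h⟩
    exact ((hL.carlemanCondition hf hmom hK').mdet hmom h0).not_mindet hI
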